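/- **Setting.** Let $\Omega=B(0,1)\subset\mathbb R^2$ be the open unit disk and $\Omega'={]{-1},1[}\times S^1$, where $S^1=\mathbb R/2\pi\mathbb Z$ carries the arc length measure; functions on $\Omega$, $\Omega'$ are extended by zero to $\mathbb R^2$, $\mathbb R\times S^1$. Put $\vartheta(\varphi)=(\cos\varphi,\sin\varphi)$, $\vartheta(\varphi)^\perp=(-\sin\varphi,\cos\varphi)$. Let $\mathcal R:L^2(\Omega)\to L^2(\Omega')$ and $\mathcal R^*:L^2(\Omega')\to L^2(\Omega)$ be the Radon transform and the backprojection, given almost everywhere by $$[\mathcal Rf](s,\varphi)=\int_{\mathbb R} f\bigl(s\vartheta(\varphi)+t\vartheta(\varphi)^\perp\bigr)\,dt,\qquad [\mathcal R^*g](x)=\int_{S^1} g(x\cdot\vartheta(\varphi),\varphi)\,d\varphi .$$ For $g\in L^2(\mathbb R\times S^1)$ let $\omega_g(h,\gamma)=\bigl(\int_{S^1}\int_{\mathbb R}|g(s+h,\varphi+\gamma)-g(s,\varphi)|^2\,ds\,d\varphi\bigr)^{1/2}$. **Discretization.** Given $\delta_x,\delta_s>0$, $N,M,P\in\mathbb N$,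 $Q\ge 1$ and angles $-\pi\le\varphi_1<\dots<\varphi_Q<\pi$, set $\varphi_0=\varphi_Q-2\pi$, $\varphi_{Q+1}=\varphi_1+2\pi$, $\delta_\varphi=\max_{1\le q\le Q}(\varphi_{q+1}-\varphi_q)$, $\Delta_q=\frac{\varphi_{q+1}-\varphi_{q-1}}2$, $\Phi_q=\bigl[\frac{\varphi_{q-1}+\varphi_q}2,\frac{\varphi_q+\varphi_{q+1}}2\bigr[$ modulo $2\pi$, $s_p=\delta_s\bigl(p-\frac{P+1}2\bigr)$, $S_p=s_p+[-\frac{\delta_s}2,\frac{\delta_s}2[$, $x_{ij}=\delta_x\bigl(i-\frac{N+1}2,j-\frac{M+1}2\bigr)$, $X_{ij}=x_{ij}+[-\frac{\delta_x}2,\frac{\delta_x}2[^2$, for $1\le p\le P$, $1\le q\le Q$, $1\le i\le N$, $1\le j\le M$. All discretizations are assumed compatible: $\Omega\subset\bigcup_{i,j}X_{ij}$ and $\Omega'\subset\bigcup_{p,q}S_p\times\Phi_q$. With $w_{\delta_s}(t)=\max(0,\delta_s-|t|)$, $f_{ij}=\delta_x^{-2}\int_{X_{ij}}f$ and $g_{pq}=\frac1{\delta_s\Delta_q}\int_{S_p}\int_{\Phi_q}g(s,\varphi)\,d\varphi\,ds$,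 the discrete Radon transform and its adjoint, the discrete backprojection, are $$[\mathcal R^{\delta_x}_{\delta_s,\delta_\varphi}f](s,\varphi)=\frac{\delta_x^2}{\delta_s^2}\sum_{p,q}\chi_{S_p}(s)\chi_{\Phi_q}(\varphi)\sum_{i,j}w_{\delta_s}(x_{ij}\cdot\vartheta(\varphi_q)-s_p)f_{ij},$$ $$[(\mathcal R^{\delta_x}_{\delta_s,\delta_\varphi})^*g](x)=\sum_{i,j}\chi_{X_{ij}}(x)\sum_{p,q}\frac{\Delta_q}{\delta_s}w_{\delta_s}(x_{ij}\cdot\vartheta(\varphi_q)-s_p)g_{pq}.$$ **Theorem.** Let $\varepsilon>0$, and consider a family of compatible discretizations with $\delta_s\to0$, $\delta_\varphi=\mathcal O(\delta_s^{1+\varepsilon})$ and $\delta_x=\mathcal O(\delta_s^{1+\varepsilon})$. 1. If $f\in L^2(\Omega)$ satisfies $\omega_{\mathcal Rf}(h,0)=\mathcal O(|h|^\varepsilon)$ as $h\to0$, then $\mathcal Rf$ and all $\mathcal R^{\delta_x}_{\delta_s,\delta_\varphi}f$ lie in $L^2(\Omega')$, and $\|\mathcal R^{\delta_x}_{\delta_s,\delta_\varphi}f-\mathcal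 Rf\|_{L^2(\Omega')}=\mathcal O(\delta_s^\varepsilon)$ as $\delta_s\to0$. 2. If $g\in L^2(\Omega')$ satisfies $\omega_g(h,0)=\mathcal O(|h|^\varepsilon)$ as $h\to0$, then $\mathcal R^*g$ and all $(\mathcal R^{\delta_x}_{\delta_s,\delta_\varphi})^*g$ lie in $L^2(\Omega)$, and $\|(\mathcal R^{\delta_x}_{\delta_s,\delta_\varphi})^*g-\mathcal R^*g\|_{L^2(\Omega)}=\mathcal O(\delta_s^\varepsilon)$ as $\delta_s\to0$. -/

import Mathlib

open MeasureTheory Filter Topology Asymptotics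

noncomputable section

namespace PixelRadon

/-- The Euclidean plane. -/
abbrev Plane : Type := EuclideanSpace ℝ (Fin 2)

/-- The circle, as the additive group of angles modulo `2π`.  Its `volume` is the arc length
measure, of total mass `2π`. -/
abbrev S1 : Type := AddCircle (2 * Real.pi)

instance factTwoPiPos : Fact (0 < 2 * Real.pi) := ⟨Real.two_pi_pos⟩

/-- The unit vector `ϑ(φ) = (cos φ, sin φ)`. -/
def dir (φ : S1) : Plane := !₂[Real.cos_periodic.lift φ, Real.sin_periodic.lift φ]

/-- The unit vector `ϑ(φ)^⊥ = (-sin φ, cos φ)`. -/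
def dirPerp (φ : S1) : Plane := !₂[-Real.sin_periodic.lift φ, Real.cos_periodic.lift φ]

/-- The image domain `Ω`: the open unit disk. -/
def disk : Set Plane := Metric.ball 0 1

/-- The sinogram domain `Ω' = ]-1,1[ × S¹`. -/
def cylinder : Set (ℝ × S1) := Set.Ioo (-1) 1 ×ˢ Set.univ

/-- The Radon transform `[R f](s, φ) = ∫ f(s ϑ(φ) + t ϑ(φ)^⊥) dt`.  For `f` in `L²` with support
in the unit disk the integrand is integrable for almost every `(s, φ)`, and the almost everywhere
defined function so obtained is the value at `f` of the continuous extension of the Radon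
transform to `L²(Ω) → L²(Ω')`. -/
def radon (f : Plane → ℝ) (z : ℝ × S1) : ℝ :=
  ∫ t : ℝ, f (z.1 • dir z.2 + t • dirPerp z.2)

/-- The backprojection `[R* g](x) = ∫ g(x · ϑ(φ), φ) dφ`; for `g` in `L²` with support in
`Ω'` the integrand is integrable for almost every `x`. -/
def backproj (g : ℝ × S1 → ℝ) (x : Plane) : ℝ :=
  ∫ φ : S1, g (inner ℝ x (dir φ), φ)

/-- The `L²` modulus of continuity of a function on `ℝ × S¹`. -/
def modCont (g : ℝ × S1 → ℝ) (h : ℝ) (γ : S1) : ℝ :=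
  Real.sqrt (∫ φ : S1, ∫ s : ℝ, |g (s + h, φ + γ) - g (s, φ)| ^ 2)

/-- The `L²` norm with respect to the measure `μ`, for functions with `MemLp u 2 μ`. -/
def L2norm {α : Type*} [MeasurableSpace α] (μ : Measure α) (u : α → ℝ) : ℝ :=
  (eLpNorm u 2 μ).toReal

/-- The hat function `w_δ(t) = max(0, δ - |t|)`. -/
def hat (δ t : ℝ) : ℝ := max 0 (δ - |t|)

/-- The discretization parameters: an image grid of `N × M` pixels of size `δx`, a sinogram grid
of `P` equispaced offsets of distance `δs`, and `Q` angles `φ_1 < ⋯ < φ_Q` in `[-π, π[`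
(only the values `φ q` with `1 ≤ q ≤ Q` are ever used). -/
structure Discretization where
  N : ℕ
  M : ℕ
  P : ℕ
  Q : ℕ
  δx : ℝ
  δs : ℝ
  φ : ℕ → ℝ
  δx_pos : 0 < δx
  δs_pos : 0 < δs
  one_le_Q : 1 ≤ Q
  φ_mem : ∀ q ∈ Finset.Icc 1 Q, φ q ∈ Set.Ico (-Real.pi) Real.pi
  φ_strictMonoOn : StrictMonoOn φ (Set.Icc 1 Q)

namespace Discretization

variable (D : Discretization)

/-- The angles `φ_0, …, φ_{Q+1}`, where `φ_0 = φ_Q - 2π` and `φ_{Q+1} = φ_1 + 2π`. -/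
def angle (q : ℕ) : ℝ :=
  if q = 0 then D.φ D.Q - 2 * Real.pi
  else if q = D.Q + 1 then D.φ 1 + 2 * Real.pi
  else D.φ q

/-- The angular discretization width `δ_φ = max_{1 ≤ q ≤ Q} (φ_{q+1} - φ_q)`. -/
def δφ : ℝ :=
  (Finset.Icc 1 D.Q).sup' (Finset.nonempty_Icc.mpr D.one_le_Q)
    (fun q => D.angle (q + 1) - D.angle q)

/-- The length `Δ_q = (φ_{q+1} - φ_{q-1}) / 2` of the angular cell `Φ_q`. -/
def Δ (q : ℕ) : ℝ := (D.angle (q + 1) - D.angle (q - 1)) / 2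

/-- The angular cell `Φ_q = [(φ_{q-1} + φ_q)/2, (φ_q + φ_{q+1})/2[`, taken modulo `2π`. -/
def angCell (q : ℕ) : Set S1 :=
  (fun t : ℝ => (t : S1)) ''
    Set.Ico ((D.angle (q - 1) + D.angle q) / 2) ((D.angle q + D.angle (q + 1)) / 2)

/-- The detector offset `s_p = δ_s (p - (P+1)/2)`. -/
def offset (p : ℕ) : ℝ := D.δs * ((p : ℝ) - ((D.P : ℝ) + 1) / 2)

/-- The detector cell `S_p = s_p + [-δ_s/2, δ_s/2[`. -/
def offCell (p : ℕ) : Set ℝ := Set.Ico (D.offset p - D.δs / 2) (D.offset p + D.δs / 2)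

/-- The pixel center `x_ij = δ_x (i - (N+1)/2, j - (M+1)/2)`. -/
def center (i j : ℕ) : Plane :=
  !₂[D.δx * ((i : ℝ) - ((D.N : ℝ) + 1) / 2), D.δx * ((j : ℝ) - ((D.M : ℝ) + 1) / 2)]

/-- The pixel `X_ij = x_ij + [-δ_x/2, δ_x/2[²`. -/
def pixel (i j : ℕ) : Set Plane :=
  {x | ∀ k : Fin 2,
    x k ∈ Set.Ico (D.center i j k - D.δx / 2) (D.center i j k + D.δx / 2)}

/-- Compatibility with the domains: `Ω` is covered by the image pixels and `Ω'` is covered by the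
sinogram pixels. -/
def Compatible : Prop :=
  disk ⊆ ⋃ i ∈ Finset.Icc 1 D.N, ⋃ j ∈ Finset.Icc 1 D.M, D.pixel i j ∧
  cylinder ⊆ ⋃ p ∈ Finset.Icc 1 D.P, ⋃ q ∈ Finset.Icc 1 D.Q, D.offCell p ×ˢ D.angCell q

/-- The pixel mean `f_ij = δ_x⁻² ∫_{X_ij} f`. -/
def pixelMean (f : Plane → ℝ) (i j : ℕ) : ℝ :=
  1 / D.δx ^ 2 * ∫ x in D.pixel i j, f x

/-- The sinogram pixel mean `g_pq = (δ_s Δ_q)⁻¹ ∫_{S_p} ∫_{Φ_q} g`. -/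
def sinoMean (g : ℝ × S1 → ℝ) (p q : ℕ) : ℝ :=
  1 / (D.δs * D.Δ q) * ∫ s in D.offCell p, ∫ φ in D.angCell q, g (s, φ)

/-- The weight `w_{δ_s}(x_ij · ϑ(φ_q) - s_p)`. -/
def weight (i j p q : ℕ) : ℝ :=
  hat D.δs (inner ℝ (D.center i j) (dir (D.φ q : S1)) - D.offset p)

/-- The fully discrete pixel-driven Radon transform. -/
def discRadon (f : Plane → ℝ) (z : ℝ × S1) : ℝ :=
  D.δx ^ 2 / D.δs ^ 2 *
    ∑ p ∈ Finset.Icc 1 D.P, ∑ q ∈ Finset.Icc 1 D.Q,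
      (D.offCell p).indicator 1 z.1 * (D.angCell q).indicator 1 z.2 *
        ∑ i ∈ Finset.Icc 1 D.N, ∑ j ∈ Finset.Icc 1 D.M,
          D.weight i j p q * D.pixelMean f i j

/-- The discrete pixel-driven backprojection, the adjoint of the discrete Radon transform. -/
def discBackproj (g : ℝ × S1 → ℝ) (x : Plane) : ℝ :=
  ∑ i ∈ Finset.Icc 1 D.N, ∑ j ∈ Finset.Icc 1 D.M,
    (D.pixel i j).indicator 1 x *
      ∑ p ∈ Finset.Icc 1 D.P, ∑ q ∈ Finset.Icc 1 D.Q,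
        D.Δ q / D.δs * D.weight i j p q * D.sinoMean g p q

end Discretization

end PixelRadon

end

noncomputable section

namespace PixelRadon

/-! After multiplication by `δs ^ 2`, both discrete operators are integral operators with one common
kernel, `kernel`, used in its two variables (`discRadon_eq`, `discBackproj_eq`). That kernel is a
piecewise constant version of `hat δs (x · ϑ(φ) - s)`. It is compared with `sampledKernel`, in which
the pixel and the angle are exact and only the detector offset is sampled. The error splits into two
parts.

Sampling `x` and `φ` moves the argument of the hat by at most `ρ = δx + 2 * δφ`. As the hat is
1-Lipschitz and both kernels live on the strip of half-width `3 * δs` around a line, the kernels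
differ by at most `ρ` on that strip (`abs_kernel_sub_le`). A Schur test
(`lintegral_sq_setLIntegral_le`) bounds the resulting operator by a multiple of `ρ * δs`. Dividing
by `δs ^ 2` leaves `ρ / δs`, which is `O(δs ^ ε)` by the assumptions on `δx` and `δφ`.

Sampling the offset costs no mass. The sampled hat has integral exactly `δs ^ 2`, in the Radon case
by translation invariance and in the backprojection case because the hats at the nodes form a
partition of unity (`integral_hat_sub_node`). What remains is a local average of increments of `G =
radon f` or `G = g` over shifts of size at most `2 * δs` (`enorm_integral_mul_sub_le`). Its `L²`
norm is controlled by the modulus of continuity (`lintegral_osc_sq_le`), for the backprojection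
after the `L²` bound `lintegral_backproj_sq_le`. Only translations in `s` occur, since the angle was
already treated in the first part. -/

/-! ### Directions, rotated coordinates and integration along lines -/

lemma dir_coe (r : ℝ) : dir (r : S1) = !₂[Real.cos r, Real.sin r] := by
  simp [dir]

lemma dirPerp_coe (r : ℝ) : dirPerp (r : S1) = !₂[-Real.sin r, Real.cos r] := by
  simp [dirPerp]

lemma continuous_cos_lift : Continuous (Real.cos_periodic.lift : S1 → ℝ) :=
  continuous_quot_lift _ Real.continuous_cos

lemma continuous_sin_lift : Continuous (Real.sin_periodic.lift : S1 → ℝ) :=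
  continuous_quot_lift _ Real.continuous_sin

@[fun_prop]
lemma continuous_dir : Continuous dir := by
  refine (PiLp.continuous_toLp 2 _).comp (continuous_pi fun k => ?_)
  fin_cases k
  · exact continuous_cos_lift
  · exact continuous_sin_lift

@[fun_prop]
lemma continuous_dirPerp : Continuous dirPerp := by
  refine (PiLp.continuous_toLp 2 _).comp (continuous_pi fun k => ?_)
  fin_cases k
  · exact continuous_sin_lift.neg
  · exact continuous_cos_lift

@[fun_prop]
lemma measurable_dir : Measurable dir := continuous_dir.measurable

@[fun_prop]
lemma measurable_dirPerp : Measurable dirPerp := continuous_dirPerp.measurable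

lemma inner_plane (x y : Plane) : inner ℝ x y = x 0 * y 0 + x 1 * y 1 := by
  simp [PiLp.inner_apply, Fin.sum_univ_two, mul_comm]

lemma inner_dir_dir (φ : S1) : inner ℝ (dir φ) (dir φ) = (1 : ℝ) := by
  induction φ using QuotientAddGroup.induction_on with
  | H r =>
    rw [inner_plane]
    have h := Real.cos_sq_add_sin_sq r
    change ((dir (r : S1)) 0 * (dir (r : S1)) 0 + (dir (r : S1)) 1 * (dir (r : S1)) 1 : ℝ) = 1
    rw [dir_coe]
    simp
    linarith

lemma inner_dirPerp_dirPerp (φ : S1) : inner ℝ (dirPerp φ) (dirPerp φ) = (1 : ℝ) := by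
  induction φ using QuotientAddGroup.induction_on with
  | H r =>
    rw [inner_plane]
    have h := Real.cos_sq_add_sin_sq r
    change ((dirPerp (r : S1)) 0 * (dirPerp (r : S1)) 0
      + (dirPerp (r : S1)) 1 * (dirPerp (r : S1)) 1 : ℝ) = 1
    rw [dirPerp_coe]
    simp
    linarith

lemma inner_dirPerp_dir (φ : S1) : inner ℝ (dirPerp φ) (dir φ) = (0 : ℝ) := by
  rw [inner_plane]
  simp [dir, dirPerp]
  ring

lemma norm_dir (φ : S1) : ‖dir φ‖ = 1 := by
  have := inner_dir_dir φ
  rw [real_inner_self_eq_norm_sq] at this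
  nlinarith [norm_nonneg (dir φ)]

/-- The point `s ϑ(φ) + t ϑ(φ)^⊥`. -/
def line (φ : S1) (z : ℝ × ℝ) : Plane := z.1 • dir φ + z.2 • dirPerp φ

lemma inner_line_dir (φ : S1) (z : ℝ × ℝ) : inner ℝ (line φ z) (dir φ) = z.1 := by
  simp [line, inner_add_left, inner_smul_left, inner_dirPerp_dir, norm_dir]

lemma norm_line_sq (φ : S1) (z : ℝ × ℝ) : ‖line φ z‖ ^ 2 = z.1 ^ 2 + z.2 ^ 2 := by
  rw [← real_inner_self_eq_norm_sq]
  have h : inner ℝ (dir φ) (dirPerp φ) = (0 : ℝ) := by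
    rw [real_inner_comm]; exact inner_dirPerp_dir φ
  simp only [line, inner_add_left, inner_add_right, inner_smul_left, inner_smul_right,
    inner_dirPerp_dir, inner_dir_dir, inner_dirPerp_dirPerp, h]
  simp
  ring

lemma line_mem_disk {φ : S1} {z : ℝ × ℝ} (h : line φ z ∈ disk) : |z.1| < 1 ∧ |z.2| < 1 := by
  have h1 : ‖line φ z‖ < 1 := by simpa [disk] using h
  have h2 := norm_line_sq φ z
  have h3 : ‖line φ z‖ ^ 2 < 1 := by nlinarith [norm_nonneg (line φ z)]
  constructor <;> (apply abs_lt_of_sq_lt_sq <;> nlinarith [sq_nonneg z.1, sq_nonneg z.2])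

/-- The rotated orthonormal basis `(ϑ(φ), ϑ(φ)^⊥)`. -/
def dirBasis (φ : S1) : OrthonormalBasis (Fin 2) ℝ Plane :=
  have h : Orthonormal ℝ ![dir φ, dirPerp φ] := by
    rw [orthonormal_iff_ite]
    intro i j
    fin_cases i <;> fin_cases j <;>
      simp [inner_dirPerp_dir, inner_dir_dir, inner_dirPerp_dirPerp,
        real_inner_comm (dirPerp φ) (dir φ), -inner_self_eq_norm_sq_to_K]
  OrthonormalBasis.mk h
    (h.linearIndependent.span_eq_top_of_card_eq_finrank (by simp)).ge

lemma line_eq (φ : S1) : line φ = (dirBasis φ).repr.symm ∘ (WithLp.toLp 2) ∘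
    (MeasurableEquiv.finTwoArrow (α := ℝ)).symm := by
  funext z
  simp only [Function.comp, ← OrthonormalBasis.sum_repr_symm, Fin.sum_univ_two, line]
  simp [dirBasis, MeasurableEquiv.finTwoArrow]

/-- Rotation invariance of Lebesgue measure; with Fubini in these coordinates, integrals over the
plane become integrals over the parallel lines of direction `φ`. -/
lemma measurePreserving_line (φ : S1) : MeasurePreserving (line φ) volume volume := by
  rw [line_eq]
  exact (LinearIsometryEquiv.measurePreserving _).comp ((PiLp.volume_preserving_toLp _).comp
    (volume_preserving_finTwoArrow ℝ).symm)

lemma measurableEmbedding_line (φ : S1) : MeasurableEmbedding (line φ) := by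
  rw [line_eq]
  exact ((dirBasis φ).repr.symm.toHomeomorph.measurableEmbedding).comp
    ((MeasurableEquiv.toLp 2 (Fin 2 → ℝ)).measurableEmbedding.comp
      (MeasurableEquiv.measurableEmbedding _))

lemma lintegral_line {F : Plane → ENNReal} (hF : Measurable F) (φ : S1) :
    ∫⁻ s : ℝ, ∫⁻ t : ℝ, F (line φ (s, t)) = ∫⁻ x, F x := by
  rw [← (measurePreserving_line φ).lintegral_comp hF, Measure.volume_eq_prod,
    lintegral_prod (fun z => F (line φ z))
      (hF.comp (measurePreserving_line φ).measurable).aemeasurable]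

lemma measurableSet_disk : MeasurableSet disk := measurableSet_ball

lemma measurableSet_cylinder : MeasurableSet cylinder := measurableSet_Ioo.prod MeasurableSet.univ

/-- The integrand is constant on each line `x · ϑ(φ) = s`, and such a line meets the disk in a chord
of length at most 2. -/
lemma setLIntegral_disk_inner_le {H : ℝ → ENNReal} (hH : Measurable H) (φ : S1) :
    ∫⁻ x in disk, H (inner ℝ x (dir φ)) ≤ 2 * ∫⁻ s in Set.Ioo (-1) 1, H s := by
  rw [← lintegral_indicator measurableSet_disk, ← lintegral_line _ φ,
    ← lintegral_indicator measurableSet_Ioo, ← lintegral_const_mul _ (by measurability)]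
  · refine lintegral_mono fun s => ?_
    calc ∫⁻ t : ℝ, disk.indicator (fun x => H (inner ℝ x (dir φ))) (line φ (s, t))
        ≤ ∫⁻ t : ℝ, (Set.Icc (-1) 1).indicator
            (fun _ => (Set.Ioo (-1) 1).indicator H s) t := by
          refine lintegral_mono fun t => ?_
          by_cases h : line φ (s, t) ∈ disk
          · obtain ⟨h1, h2⟩ := line_mem_disk h
            rw [abs_lt] at h1 h2
            have h1' : s ∈ Set.Ioo (-1 : ℝ) 1 := h1
            have h2' : t ∈ Set.Icc (-1 : ℝ) 1 := ⟨h2.1.le, h2.2.le⟩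
            rw [Set.indicator_of_mem h, Set.indicator_of_mem h2', Set.indicator_of_mem h1',
              inner_line_dir]
          · simp [Set.indicator_of_notMem h]
      _ = 2 * (Set.Ioo (-1) 1).indicator H s := by
          rw [lintegral_indicator measurableSet_Icc, setLIntegral_const, mul_comm]
          norm_num
  · exact Measurable.indicator (hH.comp (by fun_prop)) measurableSet_disk

/-! ### Finite measures and squared norms as lower integrals -/

lemma volume_univ_S1 : (volume : Measure S1) Set.univ = ENNReal.ofReal (2 * Real.pi) :=
  AddCircle.measure_univ _

instance : IsFiniteMeasure (volume.restrict disk) :=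
  ⟨by simp [disk]⟩

lemma volume_cylinder_lt_top : volume cylinder < ⊤ := by
  rw [cylinder, Measure.volume_eq_prod, Measure.prod_prod, volume_univ_S1]
  simp only [Real.volume_Ioo]
  exact ENNReal.mul_lt_top ENNReal.ofReal_lt_top ENNReal.ofReal_lt_top

instance : IsFiniteMeasure (volume.restrict cylinder) :=
  ⟨by simpa using volume_cylinder_lt_top⟩

lemma sq_lintegral_le {α : Type*} [MeasurableSpace α] (μ : Measure α) {f : α → ENNReal}
    (hf : AEMeasurable f μ) : (∫⁻ a, f a ∂μ) ^ 2 ≤ μ Set.univ * ∫⁻ a, f a ^ 2 ∂μ := by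
  have h := ENNReal.lintegral_mul_le_Lp_mul_Lq μ (p := 2) (q := 2) ⟨by norm_num, by norm_num, by norm_num⟩
    (f := fun _ => 1) aemeasurable_const hf
  have h2 := pow_le_pow_left' h 2
  rw [mul_pow] at h2
  simp only [← ENNReal.rpow_mul_natCast] at h2
  norm_num at h2
  simpa using h2

lemma ofReal_L2norm_le {α : Type*} [MeasurableSpace α] {μ : Measure α} {u : α → ℝ} {C c : ℝ}
    (hC : 0 ≤ C) (hc : 0 ≤ c) (h : ∫⁻ a, ‖u a‖ₑ ^ 2 ∂μ ≤ ENNReal.ofReal (C * c ^ 2)) :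
    L2norm μ u ≤ Real.sqrt C * c := by
  have h1 : eLpNorm u 2 μ = (∫⁻ a, ‖u a‖ₑ ^ 2 ∂μ) ^ (1 / 2 : ℝ) := by
    rw [eLpNorm_eq_lintegral_rpow_enorm_toReal (by norm_num) (by norm_num)]
    simp
  unfold L2norm
  refine ENNReal.toReal_le_of_le_ofReal (by positivity) ?_
  rw [h1]
  calc _ ≤ (ENNReal.ofReal (C * c ^ 2)) ^ (1 / 2 : ℝ) := ENNReal.rpow_le_rpow h (by norm_num)
    _ = ENNReal.ofReal ((C * c ^ 2) ^ (1 / 2 : ℝ)) :=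
        ENNReal.ofReal_rpow_of_nonneg (by positivity) (by norm_num)
    _ = _ := by
      rw [← Real.sqrt_eq_rpow, Real.sqrt_mul hC, Real.sqrt_sq hc]

/-! ### Modulus of continuity and local oscillation -/

/-- The squared `L²` modulus of continuity in the first variable. -/
def sqMod (G : ℝ × S1 → ℝ) (h : ℝ) : ENNReal :=
  ∫⁻ z : ℝ × S1, ‖G (z.1 + h, z.2) - G z‖ₑ ^ 2

/-- The local oscillation `∫_{|h| ≤ 2δ} |G(s + h, φ) - G(s, φ)| dh`. -/
def osc (G : ℝ × S1 → ℝ) (δ : ℝ) (z : ℝ × S1) : ENNReal :=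
  ∫⁻ h in Set.Icc (-(2 * δ)) (2 * δ), ‖G (z.1 + h, z.2) - G z‖ₑ

lemma measurable_osc {G : ℝ × S1 → ℝ} (hG : Measurable G) (δ : ℝ) : Measurable (osc G δ) := by
  unfold osc
  refine Measurable.lintegral_prod_right' (f := fun w : (ℝ × S1) × ℝ =>
    ‖G (w.1.1 + w.2, w.1.2) - G w.1‖ₑ) ?_
  fun_prop

/-- One factor `4 * δ`, the length of the shift interval, comes from Cauchy–Schwarz; the second
comes from integrating the uniform bound `W` over that interval after Tonelli. -/
lemma lintegral_osc_sq_le {G : ℝ × S1 → ℝ} (hG : Measurable G) {δ : ℝ} (hδ : 0 ≤ δ) {W : ENNReal}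
    (hW : ∀ h ∈ Set.Icc (-(2 * δ)) (2 * δ), sqMod G h ≤ W) :
    ∫⁻ z, osc G δ z ^ 2 ≤ ENNReal.ofReal (16 * δ ^ 2) * W := by
  have hvol : volume (Set.Icc (-(2 * δ)) (2 * δ)) = ENNReal.ofReal (4 * δ) := by
    rw [Real.volume_Icc]; congr 1; ring
  have hm : Measurable fun w : (ℝ × S1) × ℝ => ‖G (w.1.1 + w.2, w.1.2) - G w.1‖ₑ ^ 2 := by fun_prop
  calc ∫⁻ z, osc G δ z ^ 2
      ≤ ∫⁻ z : ℝ × S1, ENNReal.ofReal (4 * δ) *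
          ∫⁻ h in Set.Icc (-(2 * δ)) (2 * δ), ‖G (z.1 + h, z.2) - G z‖ₑ ^ 2 := by
        refine lintegral_mono fun z => ?_
        refine (sq_lintegral_le _ (by fun_prop)).trans_eq ?_
        rw [Measure.restrict_apply_univ, hvol]
    _ = ENNReal.ofReal (4 * δ) * ∫⁻ h in Set.Icc (-(2 * δ)) (2 * δ), sqMod G h := by
        rw [lintegral_const_mul _ (Measurable.lintegral_prod_right' hm),
          lintegral_lintegral_swap hm.aemeasurable]
        rfl
    _ ≤ ENNReal.ofReal (4 * δ) * (W * ENNReal.ofReal (4 * δ)) := by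
        gcongr
        rw [← hvol, ← setLIntegral_const]
        exact setLIntegral_mono' measurableSet_Icc hW
    _ = _ := by
        rw [mul_comm W, ← mul_assoc, ← ENNReal.ofReal_mul (by positivity)]
        congr 2; ring

/-- Square integrability matters here: Bochner integrals default to 0 on nonintegrable functions, so
otherwise `modCont` need not measure the increments. -/
lemma sqMod_eq_modCont {G : ℝ × S1 → ℝ} (hG : MemLp G 2 volume) (h : ℝ) :
    sqMod G h = ENNReal.ofReal (modCont G h 0 ^ 2) := by
  have hmp : MeasurePreserving (fun z : ℝ × S1 => (z.1 + h, z.2)) volume volume :=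
    (measurePreserving_add_right volume h).prod (MeasurePreserving.id volume)
  have hd : MemLp (fun z : ℝ × S1 => G (z.1 + h, z.2) - G z) 2 volume :=
    (hG.comp_measurePreserving hmp).sub hG
  have hi : Integrable (fun z : ℝ × S1 => |G (z.1 + h, z.2) - G z| ^ 2) volume := by
    simpa using hd.integrable_norm_pow (by norm_num)
  have hsq : ∀ x : ℝ, ‖x‖ₑ ^ 2 = ENNReal.ofReal (|x| ^ 2) := fun x => by
    rw [ENNReal.ofReal_pow (abs_nonneg x), Real.enorm_eq_ofReal_abs]
  have h0 : 0 ≤ ∫ φ : S1, ∫ s : ℝ, |G (s + h, φ + 0) - G (s, φ)| ^ 2 :=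
    integral_nonneg fun φ => integral_nonneg fun s => by positivity
  rw [modCont, Real.sq_sqrt h0, sqMod]
  simp only [hsq, add_zero]
  rw [← ofReal_integral_eq_lintegral_ofReal hi (ae_of_all _ fun z => by positivity)]
  congr 1
  exact integral_prod_symm _ hi

lemma sqMod_congr {G G' : ℝ × S1 → ℝ} (h : G =ᵐ[volume] G') (r : ℝ) : sqMod G r = sqMod G' r := by
  have hmp : MeasurePreserving (fun z : ℝ × S1 => (z.1 + r, z.2)) volume volume :=
    (measurePreserving_add_right volume r).prod (MeasurePreserving.id volume)
  refine lintegral_congr_ae ?_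
  filter_upwards [h, hmp.quasiMeasurePreserving.ae_eq h] with z h1 h2
  simp only [Function.comp] at h2
  rw [h1, h2]

/-! ### The hat function and its sampling at grid nodes -/

lemma hat_nonneg (δ t : ℝ) : 0 ≤ hat δ t := le_max_left _ _

lemma hat_le {δ : ℝ} (hδ : 0 ≤ δ) (t : ℝ) : hat δ t ≤ δ :=
  max_le hδ (by linarith [abs_nonneg t])

lemma hat_eq_zero {δ t : ℝ} (h : δ ≤ |t|) : hat δ t = 0 := max_eq_left (by linarith)

lemma hat_of_le {δ t : ℝ} (h : |t| ≤ δ) : hat δ t = δ - |t| := max_eq_right (by linarith)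

lemma abs_hat_sub_le (δ a b : ℝ) : |hat δ a - hat δ b| ≤ |a - b| := by
  unfold hat
  refine (abs_max_sub_max_le_max 0 (δ - |a|) 0 (δ - |b|)).trans ?_
  refine max_le (by simp) ?_
  rw [show δ - |a| - (δ - |b|) = |b| - |a| by ring, abs_sub_comm a b]
  exact abs_abs_sub_abs_le b a

@[fun_prop]
lemma continuous_hat (δ : ℝ) : Continuous (hat δ) := by unfold hat; fun_prop

lemma hasCompactSupport_hat (δ : ℝ) : HasCompactSupport (hat δ) := by
  refine HasCompactSupport.of_support_subset_isCompact (isCompact_Icc (a := -δ) (b := δ)) ?_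
  intro t ht
  by_contra h
  exact ht (hat_eq_zero (not_lt.1 fun h' => h ⟨(abs_lt.1 h').1.le, (abs_lt.1 h').2.le⟩))

lemma integrable_hat (δ : ℝ) : Integrable (hat δ) :=
  (continuous_hat δ).integrable_of_hasCompactSupport (hasCompactSupport_hat δ)

lemma integral_hat {δ : ℝ} (hδ : 0 ≤ δ) : ∫ t, hat δ t = δ ^ 2 := by
  have h1 : ∫ t, hat δ t = ∫ t in (-δ)..δ, hat δ t := by
    rw [intervalIntegral.integral_of_le (by linarith), setIntegral_eq_integral_of_forall_compl_eq_zero]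
    intro t ht
    refine hat_eq_zero (not_lt.1 fun h' => ht ⟨(abs_lt.1 h').1, (abs_lt.1 h').2.le⟩)
  have hi : ∀ a b : ℝ, IntervalIntegrable (hat δ) volume a b := fun a b =>
    (continuous_hat δ).intervalIntegrable a b
  have h2 : ∫ t in (-δ)..0, hat δ t = ∫ t in (-δ)..0, (δ + t) := by
    refine intervalIntegral.integral_congr fun t ht => ?_
    rw [Set.uIcc_of_le (by linarith)] at ht
    have : |t| = -t := abs_of_nonpos ht.2
    rw [hat_of_le (by rw [this]; linarith [ht.1]), this]; ring
  have h3 : ∫ t in (0:ℝ)..δ, hat δ t = ∫ t in (0:ℝ)..δ, (δ - t) := by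
    refine intervalIntegral.integral_congr fun t ht => ?_
    rw [Set.uIcc_of_le hδ] at ht
    have : |t| = t := abs_of_nonneg ht.1
    rw [hat_of_le (by rw [this]; exact ht.2), this]
  rw [h1, ← intervalIntegral.integral_add_adjacent_intervals (hi (-δ) 0) (hi 0 δ), h2, h3,
    intervalIntegral.integral_add (by simp) (by simp), intervalIntegral.integral_sub (by simp) (by simp)]
  simp
  ring

/-- The node of the grid `δ (ℤ - c)` whose cell of length `δ` contains `s`. -/
def node (δ c s : ℝ) : ℝ := δ * (⌊s / δ + c + 1 / 2⌋ - c)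

@[fun_prop]
lemma measurable_node (δ c : ℝ) : Measurable (node δ c) := by
  unfold node
  have : Measurable fun s : ℝ => (⌊s / δ + c + 1 / 2⌋ : ℝ) :=
    (measurable_from_top (f := fun n : ℤ => (n : ℝ))).comp (Int.measurable_floor.comp (by fun_prop))
  fun_prop

lemma node_eq_iff {δ : ℝ} (hδ : 0 < δ) {c s : ℝ} {n : ℤ} :
    ⌊s / δ + c + 1 / 2⌋ = n ↔ s ∈ Set.Ico (δ * (n - c) - δ / 2) (δ * (n - c) + δ / 2) := by
  rw [Int.floor_eq_iff, Set.mem_Ico]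
  have h : s = δ * (s / δ) := by field_simp
  set u := s / δ
  rw [h]
  constructor <;> rintro ⟨h1, h2⟩ <;> constructor <;> nlinarith

lemma node_of_mem {δ : ℝ} (hδ : 0 < δ) {c s : ℝ} {n : ℤ}
    (h : s ∈ Set.Ico (δ * (n - c) - δ / 2) (δ * (n - c) + δ / 2)) : node δ c s = δ * (n - c) := by
  rw [node, (node_eq_iff hδ).2 h]

lemma abs_sub_node_le {δ : ℝ} (hδ : 0 < δ) (c s : ℝ) : |s - node δ c s| ≤ δ / 2 := by
  have h := (node_eq_iff (c := c) (s := s) hδ).1 rfl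
  rw [abs_le, node]
  constructor <;> linarith [h.1, h.2]

lemma hat_node_eq_zero {δ : ℝ} (hδ : 0 < δ) {c s t : ℝ} (h : 2 * δ < |t - s|) :
    hat δ (t - node δ c s) = 0 := by
  refine hat_eq_zero ?_
  have h1 := abs_sub_node_le hδ c s
  have h2 := abs_sub_le t (node δ c s) s
  rw [abs_sub_comm (node δ c s) s] at h2
  linarith

/-- Only the two nodes enclosing `t` see a nonzero hat value, and these two values are the linear
interpolation weights, which add up to `δ`. -/
lemma hat_sub_node_eq {δ : ℝ} (hδ : 0 < δ) (c t s : ℝ) :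
    hat δ (t - node δ c s) =
      (Set.Ico (δ * (⌊t / δ + c⌋ - c) - δ / 2) (δ * (⌊t / δ + c⌋ - c) + δ / 2)).indicator
        (fun _ => δ - (t - δ * (⌊t / δ + c⌋ - c))) s +
      (Set.Ico (δ * ((⌊t / δ + c⌋ + 1 : ℤ) - c) - δ / 2)
        (δ * ((⌊t / δ + c⌋ + 1 : ℤ) - c) + δ / 2)).indicator
        (fun _ => t - δ * (⌊t / δ + c⌋ - c)) s := by
  set n := ⌊t / δ + c⌋ with hn
  have hn' := Int.floor_eq_iff.1 hn.symm
  have ht : t = δ * (t / δ) := by field_simp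
  have hb1 : 0 ≤ t - δ * (n - c) := by
    set u := t / δ; rw [ht]; nlinarith [hn'.1]
  have hb2 : t - δ * (n - c) < δ := by
    set u := t / δ; rw [ht]; nlinarith [hn'.2]
  set m := ⌊s / δ + c + 1 / 2⌋ with hm
  have hnode : node δ c s = δ * (m - c) := rfl
  simp only [Set.indicator, ← node_eq_iff hδ, ← hm]
  rw [hnode]
  by_cases h1 : m = n
  · have h2 : n ≠ n + 1 := by omega
    rw [h1, if_pos rfl, if_neg h2]
    rw [hat_of_le (by rw [abs_of_nonneg hb1]; exact hb2.le), abs_of_nonneg hb1, add_zero]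
  by_cases h2 : m = n + 1
  · have h3 : t - δ * ((m : ℝ) - c) = t - δ * (n - c) - δ := by rw [h2]; push_cast; ring
    have h4 : |t - δ * (n - c) - δ| = δ - (t - δ * (n - c)) := by
      rw [abs_of_neg (by linarith)]; ring
    simp only [if_neg h1, if_pos h2]
    rw [h3, hat_of_le (by rw [h4]; linarith), h4]; ring
  · simp only [if_neg h1, if_neg h2, add_zero]
    refine hat_eq_zero ?_
    -- Every other node is at distance at least `δ` from `t`: it lies at or below index `n - 1`, or
    -- at or above `n + 2`.
    rcases lt_or_gt_of_ne h1 with h | h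
    · have : (m : ℝ) + 1 ≤ n := by exact_mod_cast h
      refine le_trans ?_ (le_abs_self _)
      nlinarith
    · have : (n : ℝ) + 2 ≤ m := by
        have : n + 2 ≤ m := by omega
        exact_mod_cast this
      refine le_trans ?_ (neg_le_abs _)
      nlinarith

/-- Partition of unity: two weights of sum `δ`, each held on a cell of length `δ`. The result does
not depend on where `t` sits in the grid, so the discrete average over offsets has no bias. -/
lemma integral_hat_sub_node {δ : ℝ} (hδ : 0 < δ) (c t : ℝ) :
    ∫ s, hat δ (t - node δ c s) = δ ^ 2 := by
  simp only [hat_sub_node_eq hδ]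
  have hvol : ∀ a : ℝ, volume.real (Set.Ico (a - δ / 2) (a + δ / 2)) = δ := fun a => by
    rw [Real.volume_real_Ico_of_le (by linarith)]; ring
  have hi : ∀ a b : ℝ, Integrable ((Set.Ico (a - δ / 2) (a + δ / 2)).indicator fun _ => b) volume :=
    fun a b => (integrable_indicator_iff measurableSet_Ico).2 (integrableOn_const (by simp) (by simp))
  rw [integral_add (hi _ _) (hi _ _), integral_indicator measurableSet_Ico,
    integral_indicator measurableSet_Ico, setIntegral_const, setIntegral_const, hvol, hvol]
  simp only [smul_eq_mul]
  ring

/-! ### Geometry of the grids: angular cells, detector cells, pixels -/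

namespace Discretization

variable (D : Discretization)

lemma angle_lt_succ {q : ℕ} (hq : q ≤ D.Q) : D.angle q < D.angle (q + 1) := by
  have hQ := D.one_le_Q
  have h1 := D.φ_mem 1 (Finset.mem_Icc.2 ⟨le_rfl, hQ⟩)
  have h2 := D.φ_mem D.Q (Finset.mem_Icc.2 ⟨hQ, le_rfl⟩)
  -- The first and last gaps cross the periodic extension; they are positive because `φ 1` and `φ Q`
  -- lie in the same half-open period. This also covers `Q = 1`.
  rcases Nat.eq_zero_or_pos q with rfl | hq0
  · have h3 : (0 + 1 : ℕ) ≠ D.Q + 1 := by omega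
    simp only [angle, if_true, if_neg h3]
    norm_num
    linarith [h1.1, h2.2]
  · rcases hq.eq_or_lt with rfl | hlt
    · simp only [angle, if_true, if_neg (show D.Q ≠ 0 by omega),
        if_neg (show D.Q ≠ D.Q + 1 by omega), if_neg (show D.Q + 1 ≠ 0 by omega)]
      linarith [h1.1, h2.2]
    · simp only [angle, if_neg (show q ≠ 0 by omega), if_neg (show q ≠ D.Q + 1 by omega),
        if_neg (show q + 1 ≠ 0 by omega), if_neg (show q + 1 ≠ D.Q + 1 by omega)]
      exact D.φ_strictMonoOn ⟨hq0, hq⟩ ⟨by omega, hlt⟩ (by omega)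

lemma angle_of_mem {q : ℕ} (hq : q ∈ Finset.Icc 1 D.Q) : D.angle q = D.φ q := by
  rw [Finset.mem_Icc] at hq
  simp only [angle, if_neg (show q ≠ 0 by omega), if_neg (show q ≠ D.Q + 1 by omega)]

lemma angle_zero : D.angle 0 = D.angle D.Q - 2 * Real.pi := by
  have hQ := D.one_le_Q
  simp only [angle, if_true, if_neg (show D.Q ≠ 0 by omega), if_neg (show D.Q ≠ D.Q + 1 by omega)]

lemma angle_Q_succ : D.angle (D.Q + 1) = D.angle 1 + 2 * Real.pi := by
  have hQ := D.one_le_Q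
  rw [D.angle_of_mem (q := 1) (Finset.mem_Icc.2 ⟨le_rfl, hQ⟩)]
  simp [angle]

/-- The gap at index 0 is the gap at index `Q` shifted by `2π`, so the maximum over `1 ≤ q ≤ Q`
controls it too. -/
lemma angle_succ_sub_le {q : ℕ} (hq : q ≤ D.Q) : D.angle (q + 1) - D.angle q ≤ D.δφ := by
  have hQ := D.one_le_Q
  have key : ∀ q ∈ Finset.Icc 1 D.Q, D.angle (q + 1) - D.angle q ≤ D.δφ := fun q hq =>
    Finset.le_sup' (fun q => D.angle (q + 1) - D.angle q) hq
  rcases Nat.eq_zero_or_pos q with rfl | hq0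
  · have := key D.Q (Finset.mem_Icc.2 ⟨hQ, le_rfl⟩)
    rw [angle_Q_succ] at this
    rw [angle_zero]
    simpa [sub_sub_eq_add_sub, add_sub_right_comm] using this
  · exact key q (Finset.mem_Icc.2 ⟨hq0, hq⟩)

lemma δφ_nonneg : 0 ≤ D.δφ := by
  have h := D.angle_succ_sub_le le_rfl
  linarith [D.angle_lt_succ le_rfl]

lemma Δ_pos {q : ℕ} (hq : q ∈ Finset.Icc 1 D.Q) : 0 < D.Δ q := by
  rw [Finset.mem_Icc] at hq
  have h1 := D.angle_lt_succ hq.2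
  have h2 := D.angle_lt_succ (q := q - 1) (by omega)
  rw [Nat.sub_add_cancel hq.1] at h2
  unfold Δ
  linarith

/-- The end points of the angular cells. -/
def mid (q : ℕ) : ℝ := (D.angle q + D.angle (q + 1)) / 2

/-- The cells tile exactly one period. This lets membership of a cell be read off from a real
representative. -/
lemma mid_Q : D.mid D.Q = D.mid 0 + 2 * Real.pi := by
  simp only [mid, angle_Q_succ, angle_zero, zero_add]; ring

lemma mid_mono {a b : ℕ} (hab : a ≤ b) (hb : b ≤ D.Q) : D.mid a ≤ D.mid b := by
  induction b, hab using Nat.le_induction with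
  | base => exact le_rfl
  | succ n hn ih =>
    refine (ih (by omega)).trans ?_
    have h1 := D.angle_lt_succ (q := n) (by omega)
    have h2 := D.angle_lt_succ (q := n + 1) (by omega)
    unfold mid
    linarith

lemma angCell_eq {q : ℕ} (hq : q ∈ Finset.Icc 1 D.Q) :
    D.angCell q = (fun t : ℝ => (t : S1)) '' Set.Ico (D.mid (q - 1)) (D.mid q) := by
  rw [Finset.mem_Icc] at hq
  simp only [angCell, mid, Nat.sub_add_cancel hq.1]

/-- The representative of an angle in the period tiled by the angular cells. -/
def rep (φ : S1) : ℝ := AddCircle.equivIco (2 * Real.pi) (D.mid 0) φ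

lemma measurable_rep : Measurable D.rep :=
  measurable_subtype_coe.comp (AddCircle.measurableEquivIco (2 * Real.pi) (D.mid 0)).measurable

lemma coe_rep (φ : S1) : ((D.rep φ : ℝ) : S1) = φ :=
  (AddCircle.equivIco (2 * Real.pi) (D.mid 0)).symm_apply_apply φ

lemma rep_coe {t : ℝ} (ht : t ∈ Set.Ico (D.mid 0) (D.mid 0 + 2 * Real.pi)) :
    D.rep (t : S1) = t :=
  congrArg Subtype.val ((AddCircle.equivIco (2 * Real.pi) (D.mid 0)).apply_symm_apply ⟨t, ht⟩)

lemma mem_angCell_iff {q : ℕ} (hq : q ∈ Finset.Icc 1 D.Q) {φ : S1} :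
    φ ∈ D.angCell q ↔ D.rep φ ∈ Set.Ico (D.mid (q - 1)) (D.mid q) := by
  rw [D.angCell_eq hq]
  rw [Finset.mem_Icc] at hq
  constructor
  · rintro ⟨t, ht, rfl⟩
    have h : D.rep (t : S1) = t := D.rep_coe ⟨(D.mid_mono (Nat.zero_le _) (by omega)).trans ht.1,
      ht.2.trans_le (D.mid_Q ▸ D.mid_mono hq.2 le_rfl)⟩
    simp only [h]
    exact ht
  · exact fun h => ⟨_, h, D.coe_rep φ⟩

lemma measurableSet_angCell {q : ℕ} (hq : q ∈ Finset.Icc 1 D.Q) : MeasurableSet (D.angCell q) := by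
  have : D.angCell q = D.rep ⁻¹' Set.Ico (D.mid (q - 1)) (D.mid q) := by
    ext φ; exact D.mem_angCell_iff hq
  rw [this]
  exact D.measurable_rep measurableSet_Ico

lemma angCell_unique {q q' : ℕ} (hq : q ∈ Finset.Icc 1 D.Q) (hq' : q' ∈ Finset.Icc 1 D.Q) {φ : S1}
    (h : φ ∈ D.angCell q) (h' : φ ∈ D.angCell q') : q = q' := by
  rw [D.mem_angCell_iff hq] at h
  rw [D.mem_angCell_iff hq'] at h'
  rw [Finset.mem_Icc] at hq hq'
  by_contra hne
  rcases lt_or_gt_of_ne hne with hlt | hlt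
  · have := D.mid_mono (a := q) (b := q' - 1) (by omega) (by omega)
    linarith [h.2, h'.1]
  · have := D.mid_mono (a := q') (b := q - 1) (by omega) (by omega)
    linarith [h'.2, h.1]

lemma abs_rep_sub_le {q : ℕ} (hq : q ∈ Finset.Icc 1 D.Q) {φ : S1} (h : φ ∈ D.angCell q) :
    |D.rep φ - D.φ q| ≤ D.δφ := by
  have hang := D.angle_of_mem hq
  rw [D.mem_angCell_iff hq] at h
  rw [Finset.mem_Icc] at hq
  have h1 := D.angle_succ_sub_le hq.2
  have h2 := D.angle_succ_sub_le (q := q - 1) (by omega)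
  have h3 := D.angle_lt_succ hq.2
  have h4 := D.angle_lt_succ (q := q - 1) (by omega)
  simp only [mid, Nat.sub_add_cancel hq.1] at h h2 h4
  rw [abs_le]
  constructor <;> linarith [h.1, h.2]

lemma measurableSet_offCell (p : ℕ) : MeasurableSet (D.offCell p) := measurableSet_Ico

lemma node_of_mem_offCell {p : ℕ} {s : ℝ} (h : s ∈ D.offCell p) :
    node D.δs (((D.P : ℝ) + 1) / 2) s = D.offset p :=
  node_of_mem (n := (p : ℤ)) D.δs_pos (by simpa [offCell, offset] using h)

lemma grid_unique {δ c s : ℝ} (hδ : 0 < δ) {a b : ℕ}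
    (ha : s ∈ Set.Ico (δ * (a - c) - δ / 2) (δ * (a - c) + δ / 2))
    (hb : s ∈ Set.Ico (δ * (b - c) - δ / 2) (δ * (b - c) + δ / 2)) : a = b := by
  have h1 := (node_eq_iff (n := (a : ℤ)) hδ).2 (by simpa using ha)
  have h2 := (node_eq_iff (n := (b : ℤ)) hδ).2 (by simpa using hb)
  exact_mod_cast h1.symm.trans h2

lemma offCell_unique {p p' : ℕ} {s : ℝ} (h : s ∈ D.offCell p) (h' : s ∈ D.offCell p') : p = p' :=
  grid_unique D.δs_pos h h'

lemma pixel_unique {i j i' j' : ℕ} {x : Plane} (h : x ∈ D.pixel i j) (h' : x ∈ D.pixel i' j') :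
    i = i' ∧ j = j' := by
  have h0 := h 0
  have h0' := h' 0
  have h1 := h 1
  have h1' := h' 1
  simp only [center] at h0 h0' h1 h1'
  exact ⟨grid_unique D.δx_pos (by simpa using h0) (by simpa using h0'),
    grid_unique D.δx_pos (by simpa using h1) (by simpa using h1')⟩

lemma measurableSet_pixel (i j : ℕ) : MeasurableSet (D.pixel i j) := by
  have : D.pixel i j = ⋂ k : Fin 2, (fun x : Plane => x k) ⁻¹'
      Set.Ico (D.center i j k - D.δx / 2) (D.center i j k + D.δx / 2) := by
    ext x; simp [pixel]
  rw [this]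
  exact MeasurableSet.iInter fun k => (by fun_prop : Measurable fun x : Plane => x k) measurableSet_Ico

lemma abs_coord_dir_le (φ : S1) (k : Fin 2) : |dir φ k| ≤ 1 := by
  have := PiLp.norm_apply_le (dir φ) k
  rwa [norm_dir, Real.norm_eq_abs] at this

/-- Split the difference as `x · (ϑ(φ) - ϑ(φ_q)) + (x - x_ij) · ϑ(φ_q)`. Each of the two coordinates
contributes at most `δφ` and `δx / 2`. -/
lemma abs_inner_sub_inner_le {i j q : ℕ} (hq : q ∈ Finset.Icc 1 D.Q) {x : Plane} {φ : S1}
    (hx : x ∈ disk) (hij : x ∈ D.pixel i j) (hφ : φ ∈ D.angCell q) :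
    |inner ℝ x (dir φ) - inner ℝ (D.center i j) (dir (D.φ q : S1))| ≤ D.δx + 2 * D.δφ := by
  have hr := D.abs_rep_sub_le hq hφ
  have hx1 : ‖x‖ < 1 := by simpa [disk] using hx
  have hxk : ∀ k, |x k| ≤ 1 := fun k =>
    (Real.norm_eq_abs _ ▸ PiLp.norm_apply_le x k).trans hx1.le
  have hpk : ∀ k, |x k - D.center i j k| ≤ D.δx / 2 := fun k => by
    have := hij k
    rw [abs_le]; constructor <;> linarith [this.1, this.2]
  have hd : ∀ k, |dir φ k - dir (D.φ q : S1) k| ≤ D.δφ := fun k => by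
    refine le_trans ?_ hr
    rw [← D.coe_rep φ, D.rep_coe (t := D.rep φ), dir_coe, dir_coe]
    · fin_cases k
      · simpa using Real.abs_cos_sub_cos_le _ _
      · simpa using Real.abs_sin_sub_sin_le _ _
    · exact (AddCircle.equivIco (2 * Real.pi) (D.mid 0) φ).2
  have hm : ∀ k, |x k * (dir φ k - dir (D.φ q : S1) k)| ≤ D.δφ := fun k => by
    rw [abs_mul]
    nlinarith [hxk k, hd k, abs_nonneg (x k), abs_nonneg (dir φ k - dir (D.φ q : S1) k)]
  have hm' : ∀ k, |(x k - D.center i j k) * dir (D.φ q : S1) k| ≤ D.δx / 2 := fun k => by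
    rw [abs_mul]
    nlinarith [hpk k, abs_coord_dir_le (D.φ q : S1) k, abs_nonneg (x k - D.center i j k),
      abs_nonneg (dir (D.φ q : S1) k)]
  rw [inner_plane, inner_plane]
  have h0 := abs_le.1 (hm 0)
  have h1 := abs_le.1 (hm 1)
  have h0' := abs_le.1 (hm' 0)
  have h1' := abs_le.1 (hm' 1)
  rw [abs_le]
  constructor <;> linarith

/-! ### The discrete kernel and its comparison with the sampled hat -/

/-- The integral kernel, up to the factor `δ_s⁻²`, of the discrete Radon transform. -/
def kernel (x : Plane) (z : ℝ × S1) : ℝ :=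
  ∑ i ∈ Finset.Icc 1 D.N, ∑ j ∈ Finset.Icc 1 D.M, ∑ p ∈ Finset.Icc 1 D.P, ∑ q ∈ Finset.Icc 1 D.Q,
    (D.pixel i j).indicator 1 x *
      ((D.offCell p).indicator 1 z.1 * (D.angCell q).indicator 1 z.2 * D.weight i j p q)

lemma measurable_kernel : Measurable fun w : Plane × (ℝ × S1) => D.kernel w.1 w.2 := by
  unfold kernel
  refine Finset.measurable_sum _ fun i _ => Finset.measurable_sum _ fun j _ =>
    Finset.measurable_sum _ fun p _ => Finset.measurable_sum _ fun q hq => ?_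
  have h1 : Measurable fun w : Plane × (ℝ × S1) => (D.pixel i j).indicator (1 : Plane → ℝ) w.1 :=
    (measurable_one.indicator (D.measurableSet_pixel i j)).comp measurable_fst
  have h2 : Measurable fun w : Plane × (ℝ × S1) => (D.offCell p).indicator (1 : ℝ → ℝ) w.2.1 :=
    (measurable_one.indicator (D.measurableSet_offCell p)).comp (by fun_prop)
  have h3 : Measurable fun w : Plane × (ℝ × S1) => (D.angCell q).indicator (1 : S1 → ℝ) w.2.2 :=
    (measurable_one.indicator (D.measurableSet_angCell hq)).comp (by fun_prop)
  exact h1.mul ((h2.mul h3).mul_const _)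

lemma kernel_of_mem {i j p q : ℕ} (hi : i ∈ Finset.Icc 1 D.N) (hj : j ∈ Finset.Icc 1 D.M)
    (hp : p ∈ Finset.Icc 1 D.P) (hq : q ∈ Finset.Icc 1 D.Q) {x : Plane} {z : ℝ × S1}
    (hx : x ∈ D.pixel i j) (hz : z.1 ∈ D.offCell p) (hz' : z.2 ∈ D.angCell q) :
    D.kernel x z = D.weight i j p q := by
  unfold kernel
  rw [Finset.sum_eq_single_of_mem i hi, Finset.sum_eq_single_of_mem j hj,
    Finset.sum_eq_single_of_mem p hp, Finset.sum_eq_single_of_mem q hq]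
  · simp [hx, hz, hz']
  · intro b hb hne
    rw [Set.indicator_of_notMem (s := D.angCell b) fun h => hne (D.angCell_unique hb hq h hz')]
    simp
  · intro b hb hne
    rw [Set.indicator_of_notMem (s := D.offCell b) fun h => hne (D.offCell_unique h hz)]
    simp
  · intro b hb hne
    rw [Set.indicator_of_notMem (s := D.pixel i b) fun h => hne (D.pixel_unique h hx).2]
    simp
  · intro b hb hne
    refine Finset.sum_eq_zero fun c _ => ?_
    rw [Set.indicator_of_notMem (s := D.pixel b c) fun h => hne (D.pixel_unique h hx).1]
    simp

/-- The sampled offset of a detector position. -/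
def sample (s : ℝ) : ℝ := node D.δs (((D.P : ℝ) + 1) / 2) s

/-- The exact kernel with sampled offsets. -/
def sampledKernel (x : Plane) (z : ℝ × S1) : ℝ := hat D.δs (inner ℝ x (dir z.2) - D.sample z.1)

lemma measurable_sampledKernel :
    Measurable fun w : Plane × (ℝ × S1) => D.sampledKernel w.1 w.2 := by
  unfold sampledKernel sample
  exact (continuous_hat _).measurable.comp (by fun_prop)

variable {D}

lemma abs_kernel_sub_le (hD : D.Compatible) {ρ : ℝ} (hρ : D.δx + 2 * D.δφ ≤ ρ) (hρs : ρ ≤ D.δs)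
    {x : Plane} {z : ℝ × S1} (hx : x ∈ disk) (hz : z ∈ cylinder) :
    |D.kernel x z - D.sampledKernel x z| ≤
      (Set.Icc (-(3 * D.δs)) (3 * D.δs)).indicator (fun _ => ρ) (inner ℝ x (dir z.2) - z.1) := by
  have hδ := D.δs_pos
  obtain ⟨i, hi, j, hj, hij⟩ : ∃ i ∈ Finset.Icc 1 D.N, ∃ j ∈ Finset.Icc 1 D.M, x ∈ D.pixel i j := by
    simpa only [Set.mem_iUnion, exists_prop] using hD.1 hx
  obtain ⟨p, hp, q, hq, hpq⟩ : ∃ p ∈ Finset.Icc 1 D.P, ∃ q ∈ Finset.Icc 1 D.Q,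
      z ∈ D.offCell p ×ˢ D.angCell q := by
    simpa only [Set.mem_iUnion, exists_prop] using hD.2 hz
  have hin := D.abs_inner_sub_inner_le hq hx hij hpq.2
  have hs : |z.1 - D.offset p| ≤ D.δs / 2 := by
    rw [← D.node_of_mem_offCell hpq.1]; exact abs_sub_node_le hδ _ _
  rw [D.kernel_of_mem hi hj hp hq hij hpq.1 hpq.2, sampledKernel, sample,
    D.node_of_mem_offCell hpq.1, weight]
  by_cases h : inner ℝ x (dir z.2) - z.1 ∈ Set.Icc (-(3 * D.δs)) (3 * D.δs)
  · rw [Set.indicator_of_mem h]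
    refine (abs_hat_sub_le _ _ _).trans ?_
    rw [sub_sub_sub_cancel_right, abs_sub_comm]
    linarith
  -- Off the strip both kernels vanish: the offset moves by at most `δs / 2` and the projection by
  -- at most `ρ ≤ δs`, so each hat argument still exceeds `δs` in absolute value.
  · rw [Set.indicator_of_notMem h, hat_eq_zero, hat_eq_zero, sub_zero, abs_zero]
    all_goals
      rw [Set.mem_Icc, ← abs_le, not_le] at h
      rw [abs_le] at hs hin
      rcases lt_abs.1 h with h | h
      · exact le_trans (by linarith) (le_abs_self _)
      · exact le_trans (by linarith) (neg_le_abs _)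

end Discretization

/-! ### Schur test on strips and averaging against a bump -/

/-- Schur test for the indicator kernel of `A`: Cauchy–Schwarz on each slice costs `b`, and
exchanging the integrals costs `a`. -/
lemma lintegral_sq_setLIntegral_le {α β : Type*} [MeasurableSpace α] [MeasurableSpace β]
    {μ : Measure α} {ν : Measure β} [SFinite μ] [SFinite ν] {A : Set (α × β)}
    (hA : MeasurableSet A) {a b : ENNReal} (ha : ∀ x, ν {y | (x, y) ∈ A} ≤ a)
    (hb : ∀ y, μ {x | (x, y) ∈ A} ≤ b) {u : α → ENNReal} (hu : Measurable u) :
    ∫⁻ y, (∫⁻ x in {x | (x, y) ∈ A}, u x ∂μ) ^ 2 ∂ν ≤ b * a * ∫⁻ x, u x ^ 2 ∂μ := by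
  have hm : Measurable fun w : α × β => A.indicator (fun w => u w.1 ^ 2) w :=
    Measurable.indicator (by fun_prop) hA
  have hsl : ∀ y, MeasurableSet {x | (x, y) ∈ A} := fun y => hA.preimage (by fun_prop)
  have hsr : ∀ x, MeasurableSet {y | (x, y) ∈ A} := fun x => hA.preimage (by fun_prop)
  calc ∫⁻ y, (∫⁻ x in {x | (x, y) ∈ A}, u x ∂μ) ^ 2 ∂ν
      ≤ ∫⁻ y, b * ∫⁻ x, A.indicator (fun w => u w.1 ^ 2) (x, y) ∂μ ∂ν := by
        refine lintegral_mono fun y => (sq_lintegral_le _ hu.aemeasurable).trans ?_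
        rw [Measure.restrict_apply_univ, ← lintegral_indicator (hsl y)]
        gcongr with x
        · exact hb y
        · exact le_of_eq rfl
    _ = b * ∫⁻ x, u x ^ 2 * ν {y | (x, y) ∈ A} ∂μ := by
        rw [lintegral_const_mul _ (Measurable.lintegral_prod_left' hm),
          lintegral_lintegral_swap (f := fun y x => A.indicator (fun w => u w.1 ^ 2) (x, y))
            (hm.comp measurable_swap).aemeasurable]
        congr 1
        refine lintegral_congr fun x => ?_
        rw [← setLIntegral_const, ← lintegral_indicator (hsr x)]
        rfl
    _ ≤ b * ∫⁻ x, u x ^ 2 * a ∂μ := by gcongr; exact ha _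
    _ = b * a * ∫⁻ x, u x ^ 2 ∂μ := by
        rw [lintegral_mul_const _ (by fun_prop), mul_assoc, mul_comm a]

/-- The pairs `(x, (s, φ))` for which `x` lies within distance `r` of the line `(s, φ)`. -/
def strip (r : ℝ) : Set (Plane × (ℝ × S1)) :=
  {w | inner ℝ w.1 (dir w.2.2) - w.2.1 ∈ Set.Icc (-r) r}

lemma measurableSet_strip (r : ℝ) : MeasurableSet (strip r) := by
  have h : Measurable fun w : Plane × (ℝ × S1) => inner ℝ w.1 (dir w.2.2) - w.2.1 := by fun_prop
  exact h measurableSet_Icc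

/-- Width `2 * r` times chord length at most 2. -/
lemma volume_disk_strip_le (r : ℝ) (z : ℝ × S1) :
    volume.restrict disk {x | (x, z) ∈ strip r} ≤ ENNReal.ofReal (4 * r) := by
  have hs : MeasurableSet {x | (x, z) ∈ strip r} := (measurableSet_strip r).preimage (by fun_prop)
  have h := setLIntegral_disk_inner_le (H := (Set.Icc (z.1 - r) (z.1 + r)).indicator 1)
    (measurable_one.indicator measurableSet_Icc) z.2
  calc volume.restrict disk {x | (x, z) ∈ strip r}
      = ∫⁻ x in disk, (Set.Icc (z.1 - r) (z.1 + r)).indicator 1 (inner ℝ x (dir z.2)) := by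
        rw [← lintegral_indicator_one hs]
        refine lintegral_congr fun x => ?_
        refine Set.indicator_eq_indicator ?_ rfl
        simp only [strip, Set.mem_ofPred_eq, Set.mem_Icc]
        constructor <;> rintro ⟨h1, h2⟩ <;> constructor <;> linarith
    _ ≤ 2 * ∫⁻ s, (Set.Icc (z.1 - r) (z.1 + r)).indicator 1 s :=
        h.trans (by gcongr; exact Measure.restrict_le_self)
    _ = ENNReal.ofReal (4 * r) := by
        rw [lintegral_indicator_one measurableSet_Icc, Real.volume_Icc,
          show (4 : ℝ) * r = 2 * (z.1 + r - (z.1 - r)) by ring, ENNReal.ofReal_mul (by norm_num)]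
        norm_num

/-- For each angle the admissible offsets form an interval of length `2 * r`, and the angles have
total measure `2π`. -/
lemma volume_cylinder_strip_le {r : ℝ} (hr : 0 ≤ r) (x : Plane) :
    volume.restrict cylinder {z | (x, z) ∈ strip r} ≤ ENNReal.ofReal (4 * Real.pi * r) := by
  have hs : MeasurableSet {z | (x, z) ∈ strip r} := (measurableSet_strip r).preimage (by fun_prop)
  refine (Measure.restrict_apply_le _ _).trans ?_
  rw [Measure.volume_eq_prod, Measure.prod_apply_symm hs]
  calc ∫⁻ φ : S1, volume ((fun s => (s, φ)) ⁻¹' {z | (x, z) ∈ strip r})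
      = ∫⁻ φ : S1, ENNReal.ofReal (2 * r) := by
        refine lintegral_congr fun φ => ?_
        have : (fun s => (s, φ)) ⁻¹' {z | (x, z) ∈ strip r} =
            Set.Icc (inner ℝ x (dir φ) - r) (inner ℝ x (dir φ) + r) := by
          ext s
          simp only [strip, Set.mem_preimage, Set.mem_ofPred_eq, Set.mem_Icc]
          constructor <;> rintro ⟨h1, h2⟩ <;> constructor <;> linarith
        rw [this, Real.volume_Icc]
        congr 1; ring
    _ ≤ ENNReal.ofReal (4 * Real.pi * r) := by
        rw [lintegral_const, volume_univ_S1, ← ENNReal.ofReal_mul (by positivity)]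
        exact le_of_eq (by congr 1; ring)

/-- Because `k` has mass `δ ^ 2`, the difference equals `∫ k s * (G (s, φ) - G (a, φ))`; then use `k
≤ δ` and its support. Leaving `k` abstract serves both transforms: they sample the offset in
different variables. -/
lemma enorm_integral_mul_sub_le {δ : ℝ} {k : ℝ → ℝ} {a : ℝ} {φ : S1} {G : ℝ × S1 → ℝ}
    (hk0 : ∀ s, 0 ≤ k s) (hk : ∀ s, k s ≤ δ) (hsupp : ∀ s, 2 * δ < |s - a| → k s = 0)
    (hki : Integrable k) (hint : ∫ s, k s = δ ^ 2) (hG : Integrable fun s => k s * G (s, φ)) :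
    ‖(∫ s, k s * G (s, φ)) - δ ^ 2 * G (a, φ)‖ₑ ≤ ENNReal.ofReal δ * osc G δ (a, φ) := by
  rw [← hint, ← integral_mul_const, ← integral_sub hG (hki.mul_const _)]
  refine (enorm_integral_le_lintegral_enorm _).trans ?_
  rw [← lintegral_add_left_eq_self _ a, osc, ← lintegral_indicator measurableSet_Icc,
    ← lintegral_const_mul' _ _ ENNReal.ofReal_ne_top]
  refine lintegral_mono fun h => ?_
  rw [← mul_sub, enorm_mul]
  by_cases hh : h ∈ Set.Icc (-(2 * δ)) (2 * δ)
  · rw [Set.indicator_of_mem hh]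
    refine mul_le_mul' ?_ le_rfl
    rw [Real.enorm_eq_ofReal (hk0 _)]
    exact ENNReal.ofReal_le_ofReal (hk _)
  · rw [hsupp (a + h)]
    · simp
    · rw [Set.mem_Icc, ← abs_le, not_le] at hh
      simpa using hh

/-! ### The discrete transforms as integral operators -/

lemma sum_comm_four {A B C E : Finset ℕ} (F : ℕ → ℕ → ℕ → ℕ → ℝ) :
    ∑ p ∈ A, ∑ q ∈ B, ∑ i ∈ C, ∑ j ∈ E, F i j p q =
      ∑ i ∈ C, ∑ j ∈ E, ∑ p ∈ A, ∑ q ∈ B, F i j p q := by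
  calc _ = ∑ p ∈ A, ∑ i ∈ C, ∑ j ∈ E, ∑ q ∈ B, F i j p q := by
        refine Finset.sum_congr rfl fun p _ => ?_
        rw [Finset.sum_comm]
        exact Finset.sum_congr rfl fun i _ => Finset.sum_comm
    _ = _ := by
        rw [Finset.sum_comm]
        exact Finset.sum_congr rfl fun i _ => Finset.sum_comm

namespace Discretization

variable (D : Discretization)

/-- The maps `x` and `z` are left free so that one computation covers integration over the plane
with `z` fixed and over the sinogram with `x` fixed. -/
lemma integral_kernel_mul {α : Type*} [MeasurableSpace α] {μ : Measure α} (u : α → ℝ)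
    (x : α → Plane) (z : α → ℝ × S1)
    (hu : ∀ i j p, ∀ q ∈ Finset.Icc 1 D.Q, Integrable (fun a => (D.pixel i j).indicator 1 (x a) *
      ((D.offCell p).indicator 1 (z a).1 * (D.angCell q).indicator 1 (z a).2) * u a) μ) :
    ∫ a, D.kernel (x a) (z a) * u a ∂μ =
      ∑ i ∈ Finset.Icc 1 D.N, ∑ j ∈ Finset.Icc 1 D.M, ∑ p ∈ Finset.Icc 1 D.P,
        ∑ q ∈ Finset.Icc 1 D.Q, D.weight i j p q * ∫ a, (D.pixel i j).indicator 1 (x a) *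
          ((D.offCell p).indicator 1 (z a).1 * (D.angCell q).indicator 1 (z a).2) * u a ∂μ := by
  have hu' : ∀ i j p, ∀ q ∈ Finset.Icc 1 D.Q, Integrable (fun a => (D.pixel i j).indicator 1 (x a) *
      ((D.offCell p).indicator 1 (z a).1 * (D.angCell q).indicator 1 (z a).2 *
        D.weight i j p q) * u a) μ := fun i j p q hq => by
    refine ((hu i j p q hq).const_mul (D.weight i j p q)).congr (ae_of_all _ fun a => ?_)
    simp only
    ring
  simp only [kernel, Finset.sum_mul]
  rw [integral_finsetSum _ fun i _ => integrable_finsetSum _ fun j _ =>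
    integrable_finsetSum _ fun p _ => integrable_finsetSum _ fun q hq => hu' i j p q hq]
  refine Finset.sum_congr rfl fun i _ => ?_
  rw [integral_finsetSum _ fun j _ =>
    integrable_finsetSum _ fun p _ => integrable_finsetSum _ fun q hq => hu' i j p q hq]
  refine Finset.sum_congr rfl fun j _ => ?_
  rw [integral_finsetSum _ fun p _ => integrable_finsetSum _ fun q hq => hu' i j p q hq]
  refine Finset.sum_congr rfl fun p _ => ?_
  rw [integral_finsetSum _ fun q hq => hu' i j p q hq]
  refine Finset.sum_congr rfl fun q _ => ?_
  rw [← integral_const_mul]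
  congr 1; funext a; ring

lemma discRadon_eq {f : Plane → ℝ} (hf : Integrable f) (z : ℝ × S1) :
    D.δs ^ 2 * D.discRadon f z = ∫ x, D.kernel x z * f x := by
  have hi : ∀ (i j : ℕ) (c : ℝ) x, (D.pixel i j).indicator 1 x * c * f x =
      c * (D.pixel i j).indicator f x := fun i j c x => by
    by_cases h : x ∈ D.pixel i j <;> simp [h]
  rw [D.integral_kernel_mul (μ := volume) f (fun x => x) (fun _ => z)]
  · have hδs := D.δs_pos.ne'
    have hδx := D.δx_pos.ne'
    simp only [hi, integral_const_mul, integral_indicator (D.measurableSet_pixel _ _)]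
    simp only [discRadon, pixelMean, Finset.mul_sum]
    rw [sum_comm_four (fun i j p q => D.δs ^ 2 * (D.δx ^ 2 / D.δs ^ 2 *
      ((D.offCell p).indicator 1 z.1 * (D.angCell q).indicator 1 z.2 *
        (D.weight i j p q * (1 / D.δx ^ 2 * ∫ x in D.pixel i j, f x)))))]
    refine Finset.sum_congr rfl fun i _ => Finset.sum_congr rfl fun j _ =>
      Finset.sum_congr rfl fun p _ => Finset.sum_congr rfl fun q _ => ?_
    field_simp
  · intro i j p q _
    simp only [hi]
    exact (hf.indicator (D.measurableSet_pixel i j)).const_mul _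

lemma discBackproj_eq {g : ℝ × S1 → ℝ} (hg : Integrable g) (x : Plane) :
    D.δs ^ 2 * D.discBackproj g x = ∫ z, D.kernel x z * g z := by
  have hi : ∀ (p q : ℕ) (c : ℝ) (z : ℝ × S1), c * ((D.offCell p).indicator 1 z.1 *
      (D.angCell q).indicator 1 z.2) * g z =
      c * (D.offCell p ×ˢ D.angCell q).indicator g z := fun p q c z => by
    by_cases h : z.1 ∈ D.offCell p <;> by_cases h' : z.2 ∈ D.angCell q <;>
      simp [Set.indicator, h, h', Set.mem_prod]
  rw [D.integral_kernel_mul (μ := volume) g (fun _ => x) (fun z => z)]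
  · have hδs := D.δs_pos.ne'
    simp only [hi, integral_const_mul]
    simp only [discBackproj, sinoMean, Finset.mul_sum]
    refine Finset.sum_congr rfl fun i _ => Finset.sum_congr rfl fun j _ =>
      Finset.sum_congr rfl fun p _ => Finset.sum_congr rfl fun q hq => ?_
    rw [integral_indicator ((D.measurableSet_offCell p).prod (D.measurableSet_angCell hq)),
      Measure.volume_eq_prod, setIntegral_prod _ hg.integrableOn]
    have := (D.Δ_pos hq).ne'
    field_simp
  · intro i j p q hq
    simp only [hi]
    exact (hg.indicator ((D.measurableSet_offCell p).prod (D.measurableSet_angCell hq))).const_mul _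

end Discretization

/-! ### Measurability, `L²` bounds and almost everywhere invariance of the exact transforms -/

lemma measurable_radon {f : Plane → ℝ} (hf : Measurable f) : Measurable (radon f) := by
  unfold radon
  have h : Measurable fun w : (ℝ × S1) × ℝ => f (w.1.1 • dir w.1.2 + w.2 • dirPerp w.1.2) :=
    hf.comp (by fun_prop)
  exact (StronglyMeasurable.integral_prod_right' (f := fun w : (ℝ × S1) × ℝ =>
    f (w.1.1 • dir w.1.2 + w.2 • dirPerp w.1.2)) h.stronglyMeasurable).measurable

lemma measurable_backproj {g : ℝ × S1 → ℝ} (hg : Measurable g) : Measurable (backproj g) := by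
  unfold backproj
  have h : Measurable fun w : Plane × S1 => g (inner ℝ w.1 (dir w.2), w.2) := hg.comp (by fun_prop)
  exact (StronglyMeasurable.integral_prod_right' (f := fun w : Plane × S1 =>
    g (inner ℝ w.1 (dir w.2), w.2)) h.stronglyMeasurable).measurable

lemma lintegral_lines {F : Plane → ENNReal} (hF : Measurable F) :
    ∫⁻ z : ℝ × S1, ∫⁻ t : ℝ, F (line z.2 (z.1, t)) =
      ENNReal.ofReal (2 * Real.pi) * ∫⁻ x, F x := by
  have hm : Measurable fun w : (ℝ × S1) × ℝ => F (line w.1.2 (w.1.1, w.2)) :=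
    hF.comp (by unfold line; fun_prop)
  rw [Measure.volume_eq_prod, lintegral_prod_symm _ (Measurable.lintegral_prod_right' hm).aemeasurable]
  simp only [lintegral_line hF]
  rw [lintegral_const, volume_univ_S1, mul_comm]

/-- Cauchy–Schwarz in the angle gives `2π`, chord lengths give 2. Stated for `ENNReal`-valued `H` so
that it applies to `osc`, to norms and to indicators of null sets alike. -/
lemma lintegral_backproj_sq_le {H : ℝ × S1 → ENNReal} (hH : Measurable H) :
    ∫⁻ x in disk, (∫⁻ φ : S1, H (inner ℝ x (dir φ), φ)) ^ 2 ≤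
      ENNReal.ofReal (4 * Real.pi) * ∫⁻ z in cylinder, H z ^ 2 := by
  have hm : Measurable fun w : Plane × S1 => H (inner ℝ w.1 (dir w.2), w.2) ^ 2 :=
    (hH.comp (by fun_prop)).pow_const 2
  calc ∫⁻ x in disk, (∫⁻ φ : S1, H (inner ℝ x (dir φ), φ)) ^ 2
      ≤ ∫⁻ x in disk, ENNReal.ofReal (2 * Real.pi) * ∫⁻ φ : S1, H (inner ℝ x (dir φ), φ) ^ 2 := by
        refine lintegral_mono fun x => ?_
        rw [← volume_univ_S1]
        exact sq_lintegral_le _ (hH.comp (by fun_prop)).aemeasurable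
    _ = ENNReal.ofReal (2 * Real.pi) *
          ∫⁻ φ : S1, ∫⁻ x in disk, H (inner ℝ x (dir φ), φ) ^ 2 := by
        rw [lintegral_const_mul _ (Measurable.lintegral_prod_right' hm),
          lintegral_lintegral_swap (f := fun x φ => H (inner ℝ x (dir φ), φ) ^ 2) hm.aemeasurable]
    _ ≤ ENNReal.ofReal (2 * Real.pi) *
          ∫⁻ φ : S1, 2 * ∫⁻ s in Set.Ioo (-1) 1, H (s, φ) ^ 2 := by
        gcongr with φ
        exact setLIntegral_disk_inner_le (H := fun s => H (s, φ) ^ 2) (by fun_prop) φ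
    _ = ENNReal.ofReal (4 * Real.pi) * ∫⁻ z in cylinder, H z ^ 2 := by
        rw [cylinder, Measure.volume_eq_prod, ← Measure.prod_restrict,
          lintegral_prod_symm _ (by fun_prop), lintegral_const_mul, ← mul_assoc, Measure.restrict_univ,
          show (4 : ℝ) * Real.pi = 2 * Real.pi * 2 by ring, ENNReal.ofReal_mul (p := 2 * Real.pi)
            (by positivity), ENNReal.ofReal_ofNat]
        · exact Measurable.lintegral_prod_left' (f := fun w : ℝ × S1 => H w ^ 2) (by fun_prop)

/-- A line meets the disk only for `|t| < 1`, so Cauchy–Schwarz costs 2; integrating over all lines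
counts each point with weight `2π`. -/
lemma lintegral_radon_sq_le {f : Plane → ℝ} (hf : Measurable f) (hsupp : ∀ x ∉ disk, f x = 0) :
    ∫⁻ z, ‖radon f z‖ₑ ^ 2 ≤ ENNReal.ofReal (4 * Real.pi) * ∫⁻ x, ‖f x‖ₑ ^ 2 := by
  calc ∫⁻ z, ‖radon f z‖ₑ ^ 2
      ≤ ∫⁻ z : ℝ × S1, 2 * ∫⁻ t : ℝ, ‖f (line z.2 (z.1, t))‖ₑ ^ 2 := by
        refine lintegral_mono fun z => ?_
        have hml : Measurable fun t : ℝ => ‖f (line z.2 (z.1, t))‖ₑ :=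
          (hf.comp (by unfold line; fun_prop)).enorm
        have h0 : ∀ t ∉ Set.Icc (-1 : ℝ) 1, ‖f (line z.2 (z.1, t))‖ₑ = 0 := fun t ht => by
          rw [hsupp, enorm_zero]
          intro h
          have := abs_lt.1 (line_mem_disk h).2
          exact ht ⟨this.1.le, this.2.le⟩
        have h1 : ‖radon f z‖ₑ ≤ ∫⁻ t in Set.Icc (-1 : ℝ) 1, ‖f (line z.2 (z.1, t))‖ₑ := by
          refine (enorm_integral_le_lintegral_enorm _).trans_eq ?_
          rw [← lintegral_indicator measurableSet_Icc]
          refine lintegral_congr fun t => ?_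
          by_cases ht : t ∈ Set.Icc (-1 : ℝ) 1
          · rw [Set.indicator_of_mem ht]; rfl
          · rw [Set.indicator_of_notMem ht]; exact h0 t ht
        calc ‖radon f z‖ₑ ^ 2
            ≤ (∫⁻ t in Set.Icc (-1 : ℝ) 1, ‖f (line z.2 (z.1, t))‖ₑ) ^ 2 := by gcongr
          _ ≤ 2 * ∫⁻ t in Set.Icc (-1 : ℝ) 1, ‖f (line z.2 (z.1, t))‖ₑ ^ 2 := by
              refine (sq_lintegral_le _ hml.aemeasurable).trans_eq ?_
              rw [Measure.restrict_apply_univ, Real.volume_Icc]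
              norm_num
          _ ≤ _ := by gcongr; exact Measure.restrict_le_self
    _ = _ := by
        have hm : Measurable fun w : (ℝ × S1) × ℝ => ‖f (line w.1.2 (w.1.1, w.2))‖ₑ ^ 2 :=
          (hf.comp (by unfold line; fun_prop)).enorm.pow_const 2
        rw [lintegral_const_mul _ (Measurable.lintegral_prod_right' hm),
          lintegral_lines (F := fun x => ‖f x‖ₑ ^ 2) (by fun_prop), ← mul_assoc,
          show (4 : ℝ) * Real.pi = 2 * (2 * Real.pi) by ring, ENNReal.ofReal_mul (by positivity)]
        norm_num

lemma memLp_two_iff {α : Type*} [MeasurableSpace α] {μ : Measure α} {u : α → ℝ}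
    (hu : AEStronglyMeasurable u μ) : MemLp u 2 μ ↔ ∫⁻ a, ‖u a‖ₑ ^ 2 ∂μ < ⊤ := by
  have h1 : eLpNorm u 2 μ = (∫⁻ a, ‖u a‖ₑ ^ 2 ∂μ) ^ (1 / 2 : ℝ) := by
    rw [eLpNorm_eq_lintegral_rpow_enorm_toReal (by norm_num) (by norm_num)]
    simp
  rw [MemLp, h1, ENNReal.rpow_lt_top_iff_of_pos (by norm_num)]
  exact and_iff_right hu

lemma lintegral_eq_setLIntegral {α : Type*} [MeasurableSpace α] {μ : Measure α} {s : Set α}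
    (hs : MeasurableSet s) {u : α → ENNReal} (hsupp : ∀ x ∉ s, u x = 0) :
    ∫⁻ x, u x ∂μ = ∫⁻ x in s, u x ∂μ := by
  rw [← lintegral_indicator hs]
  refine lintegral_congr fun x => ?_
  by_cases h : x ∈ s
  · rw [Set.indicator_of_mem h]
  · rw [Set.indicator_of_notMem h, hsupp x h]

/-- By `lintegral_lines`, a null set of the plane meets almost every line in a null set. -/
lemma radon_congr_ae {f f' : Plane → ℝ} (h : f =ᵐ[volume] f') : radon f =ᵐ[volume] radon f' := by
  have hN : volume (toMeasurable volume {x | f x ≠ f' x}) = 0 := by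
    rw [measure_toMeasurable]; exact h
  set N := toMeasurable volume {x | f x ≠ f' x}
  have hNm : MeasurableSet N := measurableSet_toMeasurable _ _
  have hF : Measurable (N.indicator (1 : Plane → ENNReal)) := measurable_one.indicator hNm
  have hm : Measurable fun w : (ℝ × S1) × ℝ =>
      N.indicator (1 : Plane → ENNReal) (line w.1.2 (w.1.1, w.2)) :=
    hF.comp (by unfold line; fun_prop)
  have h0 := lintegral_lines hF
  rw [lintegral_indicator_one hNm, hN, mul_zero,
    lintegral_eq_zero_iff (Measurable.lintegral_prod_right' hm)] at h0
  filter_upwards [h0] with z hz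
  have hmz : Measurable fun t : ℝ => N.indicator (1 : Plane → ENNReal) (line z.2 (z.1, t)) :=
    hm.comp (measurable_const.prodMk measurable_id)
  have hz' := (lintegral_eq_zero_iff hmz).1 hz
  refine integral_congr_ae ?_
  filter_upwards [hz'] with t ht
  by_contra hne
  have : line z.2 (z.1, t) ∈ N := subset_toMeasurable _ _ hne
  simp [this] at ht

/-- The `L²` bound applied to the indicator of a null set shows that, for almost every `x` in the
disk, its curve `φ ↦ (x · ϑ(φ), φ)` meets that set in a null set of angles. -/
lemma backproj_congr_ae {g g' : ℝ × S1 → ℝ} (h : g =ᵐ[volume] g') :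
    backproj g =ᵐ[volume.restrict disk] backproj g' := by
  have hN : volume (toMeasurable volume {x | g x ≠ g' x}) = 0 := by
    rw [measure_toMeasurable]; exact h
  set N := toMeasurable volume {x | g x ≠ g' x}
  have hNm : MeasurableSet N := measurableSet_toMeasurable _ _
  have hF : Measurable (N.indicator (1 : ℝ × S1 → ENNReal)) := measurable_one.indicator hNm
  have hm : Measurable fun w : Plane × S1 =>
      N.indicator (1 : ℝ × S1 → ENNReal) (inner ℝ w.1 (dir w.2), w.2) :=
    hF.comp (by fun_prop)
  have h0 := lintegral_backproj_sq_le hF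
  have h1 : ∫⁻ z in cylinder, N.indicator (1 : ℝ × S1 → ENNReal) z ^ 2 = 0 := by
    have : ∀ z, N.indicator (1 : ℝ × S1 → ENNReal) z ^ 2 = N.indicator 1 z := fun z => by
      by_cases h : z ∈ N <;> simp [h]
    simp only [this]
    rw [lintegral_indicator_one hNm]
    exact le_antisymm ((Measure.restrict_apply_le _ _).trans_eq hN) zero_le
  rw [h1, mul_zero, nonpos_iff_eq_zero,
    lintegral_eq_zero_iff ((Measurable.lintegral_prod_right' hm).pow_const 2)] at h0
  filter_upwards [h0] with x hx
  have hmx : Measurable fun φ : S1 =>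
      N.indicator (1 : ℝ × S1 → ENNReal) (inner ℝ x (dir φ), φ) := hF.comp (by fun_prop)
  have hx' := (lintegral_eq_zero_iff hmx).1 (by simpa using hx)
  refine integral_congr_ae ?_
  filter_upwards [hx'] with φ hφ
  by_contra hne
  have : (inner ℝ x (dir φ), φ) ∈ N := subset_toMeasurable _ _ hne
  simp [this] at hφ

/-! ### Pointwise and `L²` error estimates -/

lemma enorm_integral_mul_sub_integral_mul_le {α : Type*} [MeasurableSpace α] {μ : Measure α}
    {s A : Set α} (hs : MeasurableSet s) (hA : MeasurableSet A) {k₁ k₂ u : α → ℝ} {ρ δ : ℝ}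
    (hρ : 0 ≤ ρ) (hk₁ : Measurable k₁) (hk₂ : Measurable k₂) (hu : Integrable u μ)
    (hsupp : ∀ a ∉ s, u a = 0) (hk : ∀ a ∈ s, |k₁ a - k₂ a| ≤ A.indicator (fun _ => ρ) a)
    (hb : ∀ a, |k₂ a| ≤ δ) :
    ‖(∫ a, k₁ a * u a ∂μ) - ∫ a, k₂ a * u a ∂μ‖ₑ ≤
      ENNReal.ofReal ρ * ∫⁻ a in A, ‖u a‖ₑ ∂(μ.restrict s) := by
  have hi₂ : Integrable (fun a => k₂ a * u a) μ := hu.bdd_mul hk₂.aestronglyMeasurable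
    (ae_of_all _ hb)
  have hind : ∀ a, A.indicator (fun _ => ρ) a ≤ ρ := fun a =>
    Set.indicator_apply_le' (fun _ => le_rfl) fun _ => hρ
  have hid : Integrable (fun a => (k₁ a - k₂ a) * u a) μ := by
    refine (hu.norm.const_mul ρ).mono' ((hk₁.sub hk₂).aestronglyMeasurable.mul
      hu.aestronglyMeasurable) (ae_of_all _ fun a => ?_)
    by_cases h : a ∈ s
    · rw [norm_mul]
      gcongr
      exact (hk a h).trans (hind a)
    · simp [hsupp a h]
  -- No bound on `k₁` itself is assumed; its integrability against `u` is inherited from `k₂` and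
  -- the difference.
  have hi₁ : Integrable (fun a => k₁ a * u a) μ :=
    (hid.add hi₂).congr (ae_of_all _ fun a => by simp only [Pi.add_apply]; ring)
  rw [← integral_sub hi₁ hi₂]
  refine (enorm_integral_le_lintegral_enorm _).trans ?_
  rw [lintegral_eq_setLIntegral hs (fun a ha => by simp [hsupp a ha]),
    ← lintegral_indicator hA, ← lintegral_const_mul' _ _ ENNReal.ofReal_ne_top]
  refine setLIntegral_mono' hs fun a ha => ?_
  rw [← sub_mul, enorm_mul]
  have h := hk a ha
  by_cases haA : a ∈ A
  · rw [Set.indicator_of_mem haA] at h ⊢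
    refine mul_le_mul' ?_ le_rfl
    rw [Real.enorm_eq_ofReal_abs]
    exact ENNReal.ofReal_le_ofReal h
  · rw [Set.indicator_of_notMem haA] at h
    rw [abs_nonpos_iff.1 h]
    simp

lemma sq_add_le_two_mul (a b : ENNReal) : (a + b) ^ 2 ≤ 2 * a ^ 2 + 2 * b ^ 2 := by
  rcases eq_or_ne a ⊤ with rfl | ha
  · simp
  rcases eq_or_ne b ⊤ with rfl | hb
  · simp
  lift a to NNReal using ha
  lift b to NNReal using hb
  norm_cast
  rw [← mul_add]
  exact add_sq_le

/-- Common last step of both estimates. The constant `144 * π * δ ^ 2` is the product of the strip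
measures `12 * δ` and `12 * π * δ`; `64 * π * δ ^ 2` is `4 * π`, from the backprojection bound,
times `16 * δ ^ 2`. The rest is division by `δ ^ 2` and `(a + b)² ≤ 2a² + 2b²`. -/
lemma lintegral_sq_le_of_enorm_le {α : Type*} [MeasurableSpace α] {μ : Measure α} {δ ρ : ℝ}
    (hδ : 0 < δ) (hρ : 0 ≤ ρ) {e : α → ℝ} {a b : α → ENNReal} (hb : Measurable b)
    (h : ∀ᵐ x ∂μ, ‖δ ^ 2 * e x‖ₑ ≤ ENNReal.ofReal ρ * a x + ENNReal.ofReal δ * b x)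
    {F W : ENNReal} (hF : ∫⁻ x, a x ^ 2 ∂μ ≤ ENNReal.ofReal (144 * Real.pi * δ ^ 2) * F)
    (hW : ∫⁻ x, b x ^ 2 ∂μ ≤ ENNReal.ofReal (64 * Real.pi * δ ^ 2) * W) :
    ∫⁻ x, ‖e x‖ₑ ^ 2 ∂μ ≤ ENNReal.ofReal (288 * Real.pi * (ρ / δ) ^ 2) * F +
      ENNReal.ofReal (128 * Real.pi) * W := by
  have h1 : ∀ᵐ x ∂μ, ‖e x‖ₑ ^ 2 ≤ ENNReal.ofReal (2 * (ρ / δ ^ 2) ^ 2) * a x ^ 2 +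
      ENNReal.ofReal (2 * (1 / δ) ^ 2) * b x ^ 2 := by
    filter_upwards [h] with x hx
    have h2 : ‖e x‖ₑ ≤ ENNReal.ofReal (ρ / δ ^ 2) * a x + ENNReal.ofReal (1 / δ) * b x := by
      have : e x = (1 / δ ^ 2) * (δ ^ 2 * e x) := by field_simp
      rw [this, enorm_mul, Real.enorm_eq_ofReal (r := 1 / δ ^ 2) (by positivity)]
      refine (mul_le_mul' le_rfl hx).trans_eq ?_
      rw [mul_add, ← mul_assoc, ← mul_assoc, ← ENNReal.ofReal_mul (by positivity),
        ← ENNReal.ofReal_mul (by positivity)]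
      congr 3
      · ring
      · field_simp
    refine (pow_le_pow_left' h2 2).trans ((sq_add_le_two_mul _ _).trans_eq ?_)
    rw [mul_pow, mul_pow, ENNReal.ofReal_mul (by norm_num), ENNReal.ofReal_mul (by norm_num),
      ENNReal.ofReal_pow (by positivity), ENNReal.ofReal_pow (by positivity)]
    simp [mul_assoc]
  refine (lintegral_mono_ae h1).trans ?_
  rw [lintegral_add_right _ (by fun_prop), lintegral_const_mul' _ _ ENNReal.ofReal_ne_top,
    lintegral_const_mul' _ _ ENNReal.ofReal_ne_top]
  refine (add_le_add (mul_le_mul' le_rfl hF) (mul_le_mul' le_rfl hW)).trans_eq ?_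
  rw [← mul_assoc, ← mul_assoc, ← ENNReal.ofReal_mul (by positivity),
    ← ENNReal.ofReal_mul (by positivity)]
  congr 3
  · field_simp
    ring
  · field_simp
    ring

namespace Discretization

variable {D : Discretization}

lemma ρ_nonneg : 0 ≤ D.δx + 2 * D.δφ := by linarith [D.δx_pos, D.δφ_nonneg]

lemma measurable_kernel_left (z : ℝ × S1) : Measurable fun x => D.kernel x z :=
  Measurable.of_uncurry_right (f := D.kernel) D.measurable_kernel

lemma measurable_kernel_right (x : Plane) : Measurable fun z => D.kernel x z :=
  Measurable.of_uncurry_left (f := D.kernel) D.measurable_kernel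

lemma measurable_sampledKernel_left (z : ℝ × S1) : Measurable fun x => D.sampledKernel x z :=
  Measurable.of_uncurry_right (f := D.sampledKernel) D.measurable_sampledKernel

lemma measurable_sampledKernel_right (x : Plane) : Measurable fun z => D.sampledKernel x z :=
  Measurable.of_uncurry_left (f := D.sampledKernel) D.measurable_sampledKernel

lemma abs_sampledKernel_le (x : Plane) (z : ℝ × S1) : |D.sampledKernel x z| ≤ D.δs := by
  rw [sampledKernel, abs_of_nonneg (hat_nonneg _ _)]
  exact hat_le D.δs_pos.le _

lemma abs_sub_sample_le (s : ℝ) : |s - D.sample s| ≤ D.δs / 2 := abs_sub_node_le D.δs_pos _ _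

/-- Fubini in rotated coordinates turns the sampled kernel applied to `f` into the hat average of
`radon f (·, φ)` around the sampled offset. The detector position is fixed here, so the hat is an
honest translate with mass `δs ^ 2`. -/
lemma enorm_discRadon_sub_le (hD : D.Compatible) (hρ : D.δx + 2 * D.δφ ≤ D.δs)
    {f : Plane → ℝ} (hf : Integrable f) (hsupp : ∀ x ∉ disk, f x = 0)
    {z : ℝ × S1} (hz : z ∈ cylinder) :
    ‖D.δs ^ 2 * (D.discRadon f z - radon f z)‖ₑ ≤
      ENNReal.ofReal (D.δx + 2 * D.δφ) *
        ∫⁻ x in {x | (x, z) ∈ strip (3 * D.δs)}, ‖f x‖ₑ ∂(volume.restrict disk) +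
      ENNReal.ofReal D.δs * osc (radon f) D.δs z := by
  obtain ⟨s, φ⟩ := z
  have hm₂ := D.measurable_sampledKernel_left (s, φ)
  have h1 := enorm_integral_mul_sub_integral_mul_le (μ := volume) measurableSet_disk
    (A := {x | (x, (s, φ)) ∈ strip (3 * D.δs)})
    ((measurableSet_strip _).preimage (by fun_prop)) ρ_nonneg
    (D.measurable_kernel_left (s, φ)) hm₂ hf hsupp
    (fun x hx => abs_kernel_sub_le hD le_rfl hρ hx hz) (fun x => abs_sampledKernel_le x _)
  have hsi : Integrable fun w : ℝ × ℝ => hat D.δs (w.1 - D.sample s) * f (line φ w) := by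
    have : Integrable fun x => D.sampledKernel x (s, φ) * f x :=
      hf.bdd_mul hm₂.aestronglyMeasurable (ae_of_all _ fun x => abs_sampledKernel_le x _)
    have h := ((measurePreserving_line φ).integrable_comp_emb (measurableEmbedding_line φ)).2 this
    simpa only [Function.comp_def, sampledKernel, inner_line_dir] using h
  have hmul : ∀ t : ℝ, ∫ r : ℝ, hat D.δs (t - D.sample s) * f (line φ (t, r)) =
      hat D.δs (t - D.sample s) * radon f (t, φ) := fun t => integral_const_mul _ _
  have h2 : ∫ x, D.sampledKernel x (s, φ) * f x =
      ∫ t, hat D.δs (t - D.sample s) * radon f (t, φ) := by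
    rw [← (measurePreserving_line φ).integral_comp (measurableEmbedding_line φ)]
    simp only [sampledKernel, inner_line_dir]
    rw [Measure.volume_eq_prod, integral_prod _ hsi]
    simp only [hmul]
  have hti : Integrable fun t => hat D.δs (t - D.sample s) * radon f (t, φ) := by
    have := hsi.integral_prod_left
    simpa only [hmul] using this
  have h3 := enorm_integral_mul_sub_le (δ := D.δs) (k := fun t => hat D.δs (t - D.sample s))
    (a := s) (φ := φ) (G := radon f) (fun t => hat_nonneg _ _) (fun t => hat_le D.δs_pos.le _)
    (fun t ht => by
      rw [abs_sub_comm] at ht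
      refine hat_eq_zero ?_
      have h4 := D.abs_sub_sample_le s
      have h5 := abs_sub_le s (D.sample s) t
      rw [abs_sub_comm (D.sample s) t] at h5
      linarith [D.δs_pos])
    ((integrable_hat _).comp_sub_right _)
    (by rw [integral_sub_right_eq_self (hat D.δs), integral_hat D.δs_pos.le]) hti
  rw [mul_sub, D.discRadon_eq hf, ← sub_add_sub_cancel _ (∫ x, D.sampledKernel x (s, φ) * f x)]
  refine (enorm_add_le _ _).trans (add_le_add h1 ?_)
  rw [h2]
  exact h3

lemma lintegral_discRadon_sub_sq_le (hD : D.Compatible) (hρ : D.δx + 2 * D.δφ ≤ D.δs)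
    {f : Plane → ℝ} (hfm : Measurable f) (hf : Integrable f) (hsupp : ∀ x ∉ disk, f x = 0)
    {W : ENNReal} (hW : ∀ h ∈ Set.Icc (-(2 * D.δs)) (2 * D.δs), sqMod (radon f) h ≤ W) :
    ∫⁻ z in cylinder, ‖(D.discRadon f - radon f) z‖ₑ ^ 2 ≤
      ENNReal.ofReal (288 * Real.pi * ((D.δx + 2 * D.δφ) / D.δs) ^ 2) * (∫⁻ x, ‖f x‖ₑ ^ 2) +
        ENNReal.ofReal (128 * Real.pi) * W := by
  have hδ := D.δs_pos
  refine lintegral_sq_le_of_enorm_le hδ ρ_nonneg (measurable_osc (measurable_radon hfm) D.δs)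
    ((ae_restrict_iff' measurableSet_cylinder).2
      (ae_of_all _ fun z hz => enorm_discRadon_sub_le hD hρ hf hsupp hz)) ?_ ?_
  · refine (lintegral_sq_setLIntegral_le (measurableSet_strip _)
      (volume_cylinder_strip_le (by positivity)) (volume_disk_strip_le _) hfm.enorm).trans ?_
    rw [← ENNReal.ofReal_mul (by positivity)]
    refine mul_le_mul' (le_of_eq ?_) (lintegral_mono' Measure.restrict_le_self le_rfl)
    congr 1; ring
  · refine (setLIntegral_le_lintegral _ _).trans
      ((lintegral_osc_sq_le (measurable_radon hfm) hδ.le hW).trans ?_)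
    gcongr
    -- The Radon case only needs `16 * δs ^ 2`; it is enlarged to the constant shared with the
    -- backprojection.
    nlinarith [Real.pi_gt_three]

/-- Now the sampled offset is the integration variable, so mass conservation rests on the partition
of unity. The slice hypothesis on `g` is needed to subtract the two angular integrals. -/
lemma enorm_discBackproj_sub_le (hD : D.Compatible) (hρ : D.δx + 2 * D.δφ ≤ D.δs)
    {g : ℝ × S1 → ℝ} (hg : Integrable g) (hsupp : ∀ z ∉ cylinder, g z = 0)
    {x : Plane} (hx : x ∈ disk) (hgx : Integrable fun φ : S1 => g (inner ℝ x (dir φ), φ)) :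
    ‖D.δs ^ 2 * (D.discBackproj g x - backproj g x)‖ₑ ≤
      ENNReal.ofReal (D.δx + 2 * D.δφ) *
        ∫⁻ z in {z | (x, z) ∈ strip (3 * D.δs)}, ‖g z‖ₑ ∂(volume.restrict cylinder) +
      ENNReal.ofReal D.δs * ∫⁻ φ : S1, osc g D.δs (inner ℝ x (dir φ), φ) := by
  have hδ := D.δs_pos
  have hm₂ := D.measurable_sampledKernel_right x
  have h1 := enorm_integral_mul_sub_integral_mul_le (μ := volume) measurableSet_cylinder
    (A := {z | (x, z) ∈ strip (3 * D.δs)})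
    ((measurableSet_strip _).preimage (by fun_prop)) ρ_nonneg
    (D.measurable_kernel_right x) hm₂ hg hsupp
    (fun z hz => abs_kernel_sub_le hD le_rfl hρ hx hz) (fun z => abs_sampledKernel_le x z)
  have hsi : Integrable fun z => D.sampledKernel x z * g z :=
    hg.bdd_mul hm₂.aestronglyMeasurable (ae_of_all _ fun z => abs_sampledKernel_le x z)
  rw [Measure.volume_eq_prod] at hsi
  have h2 : ∫ z, D.sampledKernel x z * g z =
      ∫ φ : S1, ∫ s : ℝ, D.sampledKernel x (s, φ) * g (s, φ) := by
    rw [Measure.volume_eq_prod, integral_prod_symm _ hsi]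
  have h3 : ‖(∫ z, D.sampledKernel x z * g z) - D.δs ^ 2 * backproj g x‖ₑ ≤
      ENNReal.ofReal D.δs * ∫⁻ φ : S1, osc g D.δs (inner ℝ x (dir φ), φ) := by
    rw [h2, backproj, ← integral_const_mul, ← integral_sub hsi.integral_prod_right
      (hgx.const_mul _), ← lintegral_const_mul' _ _ ENNReal.ofReal_ne_top]
    refine (enorm_integral_le_lintegral_enorm _).trans (lintegral_mono_ae ?_)
    filter_upwards [hsi.prod_left_ae] with φ hφ
    have hint : ∫ s, D.sampledKernel x (s, φ) = D.δs ^ 2 := by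
      simpa only [sampledKernel, sample] using
        integral_hat_sub_node hδ (((D.P : ℝ) + 1) / 2) (inner ℝ x (dir φ))
    refine enorm_integral_mul_sub_le (k := fun s => D.sampledKernel x (s, φ))
      (fun s => hat_nonneg _ _) (fun s => hat_le hδ.le _) (fun s hs => ?_) ?_ hint hφ
    · rw [abs_sub_comm] at hs
      exact hat_node_eq_zero hδ hs
    -- A nonintegrable function would have integral 0, but this one has integral `δs ^ 2 > 0`.
    · by_contra hni
      rw [integral_undef hni] at hint
      exact (pow_pos hδ 2).ne hint
  rw [mul_sub, D.discBackproj_eq hg, ← sub_add_sub_cancel _ (∫ z, D.sampledKernel x z * g z)]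
  exact (enorm_add_le _ _).trans (add_le_add h1 h3)

lemma lintegral_discBackproj_sub_sq_le (hD : D.Compatible) (hρ : D.δx + 2 * D.δφ ≤ D.δs)
    {g : ℝ × S1 → ℝ} (hgm : Measurable g) (hg : Integrable g) (hsupp : ∀ z ∉ cylinder, g z = 0)
    (hg2 : ∫⁻ z, ‖g z‖ₑ ^ 2 < ⊤)
    {W : ENNReal} (hW : ∀ h ∈ Set.Icc (-(2 * D.δs)) (2 * D.δs), sqMod g h ≤ W) :
    ∫⁻ x in disk, ‖(D.discBackproj g - backproj g) x‖ₑ ^ 2 ≤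
      ENNReal.ofReal (288 * Real.pi * ((D.δx + 2 * D.δφ) / D.δs) ^ 2) * (∫⁻ z, ‖g z‖ₑ ^ 2) +
        ENNReal.ofReal (128 * Real.pi) * W := by
  have hδ := D.δs_pos
  have hslice : ∀ᵐ x ∂(volume.restrict disk), Integrable fun φ : S1 => g (inner ℝ x (dir φ), φ) := by
    have h1 := lintegral_backproj_sq_le hgm.enorm
    have hm : Measurable fun w : Plane × S1 => ‖g (inner ℝ w.1 (dir w.2), w.2)‖ₑ :=
      (hgm.comp (by fun_prop)).enorm
    have h2 := ae_lt_top ((Measurable.lintegral_prod_right' hm).pow_const 2) (h1.trans_lt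
      (ENNReal.mul_lt_top ENNReal.ofReal_lt_top
        ((setLIntegral_le_lintegral _ _).trans_lt hg2))).ne
    filter_upwards [h2] with x hx
    refine ⟨(hgm.comp (by fun_prop)).aestronglyMeasurable, ?_⟩
    rw [hasFiniteIntegral_iff_enorm]
    exact (ENNReal.pow_lt_top_iff.1 hx).resolve_right (by norm_num)
  have hmb : Measurable fun x : Plane => ∫⁻ φ : S1, osc g D.δs (inner ℝ x (dir φ), φ) :=
    Measurable.lintegral_prod_right' (f := fun w : Plane × S1 =>
      osc g D.δs (inner ℝ w.1 (dir w.2), w.2)) ((measurable_osc hgm _).comp (by fun_prop))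
  refine lintegral_sq_le_of_enorm_le hδ ρ_nonneg hmb (by
    filter_upwards [hslice, ae_restrict_mem measurableSet_disk] with x hx hxd
    exact enorm_discBackproj_sub_le hD hρ hg hsupp hxd hx) ?_ ?_
  · refine (lintegral_sq_setLIntegral_le (μ := volume.restrict cylinder)
      (A := Prod.swap ⁻¹' strip (3 * D.δs))
      ((measurableSet_strip _).preimage measurable_swap)
      (volume_disk_strip_le _) (volume_cylinder_strip_le (by positivity)) hgm.enorm).trans ?_
    rw [← ENNReal.ofReal_mul (by positivity)]
    refine mul_le_mul' (le_of_eq ?_) (lintegral_mono' Measure.restrict_le_self le_rfl)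
    congr 1; ring
  · refine (lintegral_backproj_sq_le (measurable_osc hgm _)).trans ?_
    calc _ ≤ ENNReal.ofReal (4 * Real.pi) * (ENNReal.ofReal (16 * D.δs ^ 2) * W) := by
          gcongr
          exact (setLIntegral_le_lintegral _ _).trans (lintegral_osc_sq_le hgm hδ.le hW)
      _ = _ := by
          rw [← mul_assoc, ← ENNReal.ofReal_mul (by positivity)]
          congr 2; ring

end Discretization

/-! ### From the estimates to the convergence rate -/

lemma isBigO_L2norm_of_estimate {ε : ℝ} (hε : 0 < ε) {ι α : Type*} [MeasurableSpace α]
    {μ : Measure α} {l : Filter ι} {δ r : ι → ℝ} {m : ℝ → ℝ} {u : ι → α → ℝ} {F : ENNReal}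
    (hF : F ≠ ⊤) (hδ : ∀ i, 0 < δ i) (hr0 : ∀ i, 0 ≤ r i) (hm0 : ∀ h, 0 ≤ m h)
    (hδ0 : Tendsto δ l (𝓝 0)) (hr : r =O[l] fun i => δ i ^ (1 + ε))
    (hm : m =O[𝓝 0] fun h : ℝ => |h| ^ ε)
    (hest : ∀ i, r i ≤ δ i → ∀ W : ENNReal,
      (∀ h ∈ Set.Icc (-(2 * δ i)) (2 * δ i), ENNReal.ofReal (m h ^ 2) ≤ W) →
      ∫⁻ a, ‖u i a‖ₑ ^ 2 ∂μ ≤ ENNReal.ofReal (288 * Real.pi * (r i / δ i) ^ 2) * F +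
        ENNReal.ofReal (128 * Real.pi) * W) :
    (fun i => L2norm μ (u i)) =O[l] fun i => δ i ^ ε := by
  obtain ⟨C₁, hC₁, hr⟩ := hr.exists_pos
  obtain ⟨C₂, hC₂, hm⟩ := hm.exists_pos
  rw [isBigOWith_iff] at hr hm
  have hδε : Tendsto (fun i => C₁ * δ i ^ ε) l (𝓝 0) := by
    have := (hδ0.rpow_const (p := ε) (Or.inr hε.le)).const_mul C₁
    rwa [Real.zero_rpow hε.ne', mul_zero] at this
  obtain ⟨η, hη, hm⟩ := Metric.eventually_nhds_iff.1 hm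
  set K : ℝ := 288 * Real.pi * C₁ ^ 2 * F.toReal + 128 * Real.pi * (C₂ * 2 ^ ε) ^ 2 with hK
  have hK0 : 0 ≤ K := by positivity
  refine IsBigO.of_bound (Real.sqrt K) ?_
  filter_upwards [hr, hδε.eventually_le_const one_pos,
    hδ0.eventually_lt_const (show (0 : ℝ) < η / 2 by positivity)] with i hri h1 h2
  have hδi := hδ i
  have hpow : 0 < δ i ^ ε := Real.rpow_pos_of_pos hδi _
  rw [Real.norm_of_nonneg (hr0 i), Real.norm_of_nonneg (by positivity), Real.rpow_add hδi,
    Real.rpow_one] at hri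
  have hrδ : r i / δ i ≤ C₁ * δ i ^ ε := by
    rw [div_le_iff₀ hδi]; linarith
  -- The estimate is available only for `r i ≤ δ i`, which holds eventually since `C₁ * δ i ^ ε ≤
  -- 1`; this is where `ε > 0` enters.
  have hrδ' : r i ≤ δ i := by nlinarith
  rw [Real.norm_of_nonneg (show 0 ≤ L2norm μ (u i) from ENNReal.toReal_nonneg),
    Real.norm_of_nonneg hpow.le]
  refine ofReal_L2norm_le hK0 hpow.le ?_
  -- The shifts reach `2 * δ i`, which produces the factor `2 ^ ε` in `K`.
  refine (hest i hrδ' (ENNReal.ofReal ((C₂ * (2 * δ i) ^ ε) ^ 2)) fun h hh => ?_).trans ?_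
  · have habs : |h| ≤ 2 * δ i := abs_le.2 hh
    have h3 := hm (y := h) (by rw [Real.dist_eq, sub_zero]; linarith)
    rw [Real.norm_of_nonneg (hm0 h), Real.norm_of_nonneg (by positivity)] at h3
    refine ENNReal.ofReal_le_ofReal (pow_le_pow_left₀ (hm0 h) (h3.trans ?_) 2)
    gcongr
  · rw [← ENNReal.ofReal_toReal hF, ← ENNReal.ofReal_mul (by positivity),
      ← ENNReal.ofReal_mul (by positivity), ← ENNReal.ofReal_add (by positivity) (by positivity)]
    refine ENNReal.ofReal_le_ofReal ?_
    rw [Real.mul_rpow (by norm_num) hδi.le]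
    have h4 : (r i / δ i) ^ 2 ≤ (C₁ * δ i ^ ε) ^ 2 :=
      pow_le_pow_left₀ (div_nonneg (hr0 i) hδi.le) hrδ 2
    calc 288 * Real.pi * (r i / δ i) ^ 2 * F.toReal +
          128 * Real.pi * (C₂ * (2 ^ ε * δ i ^ ε)) ^ 2
        ≤ 288 * Real.pi * (C₁ * δ i ^ ε) ^ 2 * F.toReal +
          128 * Real.pi * (C₂ * (2 ^ ε * δ i ^ ε)) ^ 2 := by gcongr
      _ = K * (δ i ^ ε) ^ 2 := by rw [hK]; ring

/-! ### Measurable representatives and discrete transforms on classes -/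

lemma exists_measurable_representative {α : Type*} [MeasurableSpace α] {μ : Measure α} {s : Set α}
    (hs : MeasurableSet s) [IsFiniteMeasure (μ.restrict s)] {u : α → ℝ}
    (hu : MemLp u 2 (μ.restrict s)) :
    ∃ v : α → ℝ, s.indicator u =ᵐ[μ] v ∧ Measurable v ∧ (∀ x ∉ s, v x = 0) ∧ Integrable v μ ∧
      ∫⁻ x, ‖v x‖ₑ ^ 2 ∂μ < ⊤ := by
  have h2 : MemLp (s.indicator u) 2 μ := (memLp_indicator_iff_restrict hs).2 hu
  have h1 : Integrable (s.indicator u) μ :=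
    (integrable_indicator_iff hs).2 (hu.integrable (by norm_num))
  have hae : s.indicator u =ᵐ[μ] s.indicator (h1.1.mk _) := by
    filter_upwards [h1.1.ae_eq_mk] with x hx
    by_cases h : x ∈ s
    · rw [Set.indicator_of_mem (f := h1.1.mk _) h, ← hx]
    · simp [h]
  refine ⟨s.indicator (h1.1.mk _), hae, h1.1.stronglyMeasurable_mk.measurable.indicator hs,
    fun x hx => Set.indicator_of_notMem hx _, h1.congr hae, ?_⟩
  have h3 := h2.ae_eq hae
  exact (memLp_two_iff h3.1).1 h3

namespace Discretization

variable (D : Discretization)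

lemma memLp_discRadon (f : Plane → ℝ) : MemLp (D.discRadon f) 2 (volume.restrict cylinder) := by
  unfold discRadon
  refine MemLp.const_mul ?_ _
  refine memLp_finsetSum _ fun p _ => memLp_finsetSum _ fun q hq => MemLp.mul_const ?_ _
  have h : (fun z : ℝ × S1 => (D.offCell p).indicator (1 : ℝ → ℝ) z.1 *
      (D.angCell q).indicator 1 z.2) = (D.offCell p ×ˢ D.angCell q).indicator fun _ => 1 := by
    funext z
    by_cases h : z.1 ∈ D.offCell p <;> by_cases h' : z.2 ∈ D.angCell q <;>
      simp [Set.indicator, h, h', Set.mem_prod]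
  rw [h]
  exact (memLp_const 1).indicator ((D.measurableSet_offCell p).prod (D.measurableSet_angCell hq))

lemma memLp_discBackproj (g : ℝ × S1 → ℝ) :
    MemLp (D.discBackproj g) 2 (volume.restrict disk) := by
  unfold discBackproj
  refine memLp_finsetSum _ fun i _ => memLp_finsetSum _ fun j _ => MemLp.mul_const ?_ _
  exact (memLp_const 1).indicator (D.measurableSet_pixel i j)

lemma discRadon_congr_ae {f f' : Plane → ℝ} (h : f =ᵐ[volume] f') :
    D.discRadon f = D.discRadon f' := by
  have : D.pixelMean f = D.pixelMean f' := by
    funext i j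
    rw [pixelMean, pixelMean, integral_congr_ae (ae_restrict_of_ae h)]
  unfold discRadon
  rw [this]

/-- `sinoMean` is an iterated integral, which does not directly ignore null sets of the product; the
kernel representation, a single integral over the product, does. -/
lemma discBackproj_congr_ae {g g' : ℝ × S1 → ℝ} (hg : Integrable g) (h : g =ᵐ[volume] g') :
    D.discBackproj g = D.discBackproj g' := by
  funext x
  have h1 := D.discBackproj_eq hg x
  have h2 := D.discBackproj_eq (hg.congr h) x
  have h3 : ∫ z, D.kernel x z * g z = ∫ z, D.kernel x z * g' z :=
    integral_congr_ae (h.mono fun z hz => by simp only [hz])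
  rw [h3, ← h2] at h1
  exact mul_left_cancel₀ (pow_pos D.δs_pos 2).ne' h1

end Discretization

lemma L2norm_congr_ae {α : Type*} [MeasurableSpace α] {μ : Measure α} {u v : α → ℝ}
    (h : u =ᵐ[μ] v) : L2norm μ u = L2norm μ v := by
  rw [L2norm, L2norm, eLpNorm_congr_ae h]

lemma modCont_nonneg (G : ℝ × S1 → ℝ) (h : ℝ) (γ : S1) : 0 ≤ modCont G h γ := Real.sqrt_nonneg _

end PixelRadon

end

/-! ### The convergence theorem -/

theorem theorem2p9 (ε : ℝ) (hε : 0 < ε)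
    {ι : Type*} (l : Filter ι) (D : ι → PixelRadon.Discretization)
    (hcomp : ∀ i, (D i).Compatible)
    (hs : Tendsto (fun i => (D i).δs) l (𝓝 0))
    (hφ : (fun i => (D i).δφ) =O[l] (fun i => (D i).δs ^ (1 + ε)))
    (hx : (fun i => (D i).δx) =O[l] (fun i => (D i).δs ^ (1 + ε))) :
    (∀ f : PixelRadon.Plane → ℝ,
      MemLp f 2 (volume.restrict PixelRadon.disk) →
      (fun h : ℝ => PixelRadon.modCont (PixelRadon.radon (PixelRadon.disk.indicator f)) h 0)
        =O[𝓝 0] (fun h : ℝ => |h| ^ ε) →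
      MemLp (PixelRadon.radon (PixelRadon.disk.indicator f)) 2
        (volume.restrict PixelRadon.cylinder) ∧
      (∀ i, MemLp ((D i).discRadon (PixelRadon.disk.indicator f)) 2
        (volume.restrict PixelRadon.cylinder)) ∧
      (fun i => PixelRadon.L2norm (volume.restrict PixelRadon.cylinder)
          ((D i).discRadon (PixelRadon.disk.indicator f)
            - PixelRadon.radon (PixelRadon.disk.indicator f)))
        =O[l] (fun i => (D i).δs ^ ε)) ∧
    (∀ g : ℝ × PixelRadon.S1 → ℝ,
      MemLp g 2 (volume.restrict PixelRadon.cylinder) →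
      (fun h : ℝ => PixelRadon.modCont (PixelRadon.cylinder.indicator g) h 0)
        =O[𝓝 0] (fun h : ℝ => |h| ^ ε) →
      MemLp (PixelRadon.backproj (PixelRadon.cylinder.indicator g)) 2
        (volume.restrict PixelRadon.disk) ∧
      (∀ i, MemLp ((D i).discBackproj (PixelRadon.cylinder.indicator g)) 2
        (volume.restrict PixelRadon.disk)) ∧
      (fun i => PixelRadon.L2norm (volume.restrict PixelRadon.disk)
          ((D i).discBackproj (PixelRadon.cylinder.indicator g)
            - PixelRadon.backproj (PixelRadon.cylinder.indicator g)))
        =O[l] (fun i => (D i).δs ^ ε)) := by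
  have hr : (fun i => (D i).δx + 2 * (D i).δφ) =O[l] (fun i => (D i).δs ^ (1 + ε)) :=
    hx.add (hφ.const_mul_left 2)
  refine ⟨fun f hf hmod => ?_, fun g hg hmod => ?_⟩
  · obtain ⟨f', hff', hfm, hsupp, hfi, hf2⟩ :=
      PixelRadon.exists_measurable_representative PixelRadon.measurableSet_disk hf
    have hR := PixelRadon.radon_congr_ae hff'
    have hRm := PixelRadon.measurable_radon hfm
    have hR' : MemLp (PixelRadon.radon f') 2 volume :=
      (PixelRadon.memLp_two_iff hRm.aestronglyMeasurable).2
        ((PixelRadon.lintegral_radon_sq_le hfm hsupp).trans_lt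
          (ENNReal.mul_lt_top ENNReal.ofReal_lt_top hf2))
    have hR0 := hR'.ae_eq hR.symm
    refine ⟨hR0.restrict _, fun i => (D i).memLp_discRadon _, ?_⟩
    have hcongr : ∀ i, PixelRadon.L2norm (volume.restrict PixelRadon.cylinder)
        ((D i).discRadon (PixelRadon.disk.indicator f)
          - PixelRadon.radon (PixelRadon.disk.indicator f)) =
        PixelRadon.L2norm (volume.restrict PixelRadon.cylinder)
          ((D i).discRadon f' - PixelRadon.radon f') := fun i => by
      rw [(D i).discRadon_congr_ae hff']
      exact PixelRadon.L2norm_congr_ae ((EventuallyEq.refl _ _).sub (ae_restrict_of_ae hR))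
    simp only [hcongr]
    refine PixelRadon.isBigO_L2norm_of_estimate hε hf2.ne (fun i => (D i).δs_pos)
      (fun i => PixelRadon.Discretization.ρ_nonneg)
      (fun h => PixelRadon.modCont_nonneg _ h 0) hs hr hmod fun i hi W hW => ?_
    refine PixelRadon.Discretization.lintegral_discRadon_sub_sq_le (hcomp i) hi hfm hfi hsupp
      fun h hh => ?_
    -- The hypothesis concerns the original `f`; `sqMod` is insensitive to null sets, so the modulus
    -- bound passes to the representative `f'`.
    rw [← PixelRadon.sqMod_congr hR, PixelRadon.sqMod_eq_modCont hR0]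
    exact hW h hh
  · obtain ⟨g', hgg', hgm, hsupp, hgi, hg2⟩ :=
      PixelRadon.exists_measurable_representative PixelRadon.measurableSet_cylinder hg
    have hB := PixelRadon.backproj_congr_ae hgg'
    have hBm := PixelRadon.measurable_backproj hgm
    have hB' : MemLp (PixelRadon.backproj g') 2 (volume.restrict PixelRadon.disk) := by
      refine (PixelRadon.memLp_two_iff hBm.aestronglyMeasurable).2 ?_
      calc ∫⁻ x in PixelRadon.disk, ‖PixelRadon.backproj g' x‖ₑ ^ 2
          ≤ ∫⁻ x in PixelRadon.disk,
              (∫⁻ φ : PixelRadon.S1, ‖g' (inner ℝ x (PixelRadon.dir φ), φ)‖ₑ) ^ 2 :=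
            lintegral_mono fun x => pow_le_pow_left' (enorm_integral_le_lintegral_enorm _) 2
        _ ≤ ENNReal.ofReal (4 * Real.pi) * ∫⁻ z in PixelRadon.cylinder, ‖g' z‖ₑ ^ 2 :=
            PixelRadon.lintegral_backproj_sq_le hgm.enorm
        _ < ⊤ := ENNReal.mul_lt_top ENNReal.ofReal_lt_top
            ((setLIntegral_le_lintegral _ _).trans_lt hg2)
    refine ⟨hB'.ae_eq hB.symm, fun i => (D i).memLp_discBackproj _, ?_⟩
    have hg0 : MemLp (PixelRadon.cylinder.indicator g) 2 volume :=
      (memLp_indicator_iff_restrict PixelRadon.measurableSet_cylinder).2 hg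
    have hcongr : ∀ i, PixelRadon.L2norm (volume.restrict PixelRadon.disk)
        ((D i).discBackproj (PixelRadon.cylinder.indicator g)
          - PixelRadon.backproj (PixelRadon.cylinder.indicator g)) =
        PixelRadon.L2norm (volume.restrict PixelRadon.disk)
          ((D i).discBackproj g' - PixelRadon.backproj g') := fun i => by
      rw [(D i).discBackproj_congr_ae (hgi.congr hgg'.symm) hgg']
      exact PixelRadon.L2norm_congr_ae ((EventuallyEq.refl _ _).sub hB)
    simp only [hcongr]
    refine PixelRadon.isBigO_L2norm_of_estimate hε hg2.ne (fun i => (D i).δs_pos)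
      (fun i => PixelRadon.Discretization.ρ_nonneg)
      (fun h => PixelRadon.modCont_nonneg _ h 0) hs hr hmod fun i hi W hW => ?_
    refine PixelRadon.Discretization.lintegral_discBackproj_sub_sq_le (hcomp i) hi hgm hgi hsupp
      hg2 fun h hh => ?_
    rw [← PixelRadon.sqMod_congr hgg', PixelRadon.sqMod_eq_modCont hg0]
    exact hW h hh
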